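/- Let $G$ be a compact connected Lie group with Lie algebra $\mathfrak g$ and an $\mathrm{Ad}$-invariant inner product $\langle\cdot,\cdot\rangle$ on $\mathfrak g$, and let $T\cong (S^1)^r$ be a maximal torus of $G$ with Lie algebra $\mathfrak t\subset\mathfrak g$ and complexification $T_{\mathbb C}\cong(\mathbb C^*)^r$. Identify $T^*G$ with $G\times\mathfrak g$ by left translations and the inner product, and $T_{(x,y)}(T^*G)$ with $\mathfrak g\oplus\mathfrak g$; the canonical symplectic form is then $$\omega_{(x,y)}\big((U,V),(W,Z)\big)=\langle U,Z\rangle-\langle V,W\rangle+\langle y,[U,W]\rangle .$$ Let $F:\mathfrak g\to\mathfrak g$ be a self-adjoint linear map with image in $\mathfrak t$, zero on $\mathfrak t^\perp$ and positive definite on $\mathfrak t$, and let $f(x,y)=\tfrac12\langle y,Fy\rangle$. For $\sigma=\sigma_1+i\sigma_2\in\mathbb C$ let $\mathcal P_{0,\sigma}$ be the mixed polarization of $T^*G$ given at each point by $\{(-\bar\sigma FA,A)\mid A\in\mathfrak g_{\mathbb C}\}$, and let $\mathcal P_{0,\sigma}^{\mathfrak t}=\{(-\bar\sigma FA,A)\mid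 A\in\mathfrak t_{\mathbb C}\}$ be its $\mathfrak t$-part. For $(x,y)\in G\times\mathfrak g$ let $L_{(x,y)}=F_x\times\{y+\mathfrak t\}$, where $F_x=xT$ is the fiber of $G\to G/T$ containing $x$, and let $\iota:L_{(x,y)}\hookrightarrow T^*G$ be the inclusion. Theorem. Suppose $\sigma_2>0$, and let $(x,y)\in T^*G$. Then $L_{(x,y)}$ is the leaf through $(x,y)$ of the real distribution $\mathrm{Re}\,\mathcal P_{0,\sigma}^{\mathfrak t}+\mathrm{Im}\,\mathcal P_{0,\sigma}^{\mathfrak t}$ (it consists of the points that can be reached from $(x,y)$ along smooth curves tangent to this distribution). It is an embedded submanifold of $T^*G$ with a complex manifold structure such that: 1. its holomorphic tangent space $T^{(1,0)}L_{(x,y)}$ is $\mathcal P_{0,\sigma}^{\mathfrak t}$ at every point; 2. $\iota^*\omega$ is a Kähler form on it, that is, it is smooth and closed, invariant under the complex structure $J$, and $\iota^*\omega(v,Jv)>0$ for all tangent vectors $v\ne0$ (in particular $L_{(x,y)}$ is a symplectic submanifold); 3. $2\sigma_2\,\iota^*f$ is a global Kähler potential: $\iota^*\omega=i\,\partial\bar\partial\,(2\sigma_2\,\iota^*f)$;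 4. it is biholomorphic to $T_{\mathbb C}\cong(\mathbb C^*)^r$, by a biholomorphism that is equivariant for the actions of $T\cong(S^1)^r$ by right translation on $F_x$ and by multiplication on $(\mathbb C^*)^r$. -/

import Mathlib

open scoped Manifold ContDiff TensorProduct

noncomputable section

namespace KahlerLeaves

section LieGroupSide

variable {E : Type*} [NormedAddCommGroup E] [NormedSpace ℝ E]
variable (G : Type*) [TopologicalSpace G] [ChartedSpace E G] [Group G]

/-- The Lie bracket of `𝔤 = T_1 G`. In Mathlib every tangent space of a manifold modelled on `E` is
a copy of `E`; so the vector space underlying `𝔤` is `E`, and the Lie algebra structure is Mathlib's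
one on `GroupLieAlgebra` (bracket of left-invariant vector fields). -/
def bracket (U W : E) : E :=
  Bracket.bracket (L := GroupLieAlgebra 𝓘(ℝ, E) G) (M := GroupLieAlgebra 𝓘(ℝ, E) G) U W

variable {G} in
/-- The adjoint representation: the derivative at `1` of conjugation by `x`. -/
def Ad (x : G) : E →L[ℝ] E :=
  mfderiv 𝓘(ℝ, E) 𝓘(ℝ, E) (fun g : G => x * g * x⁻¹) 1

variable {G} in
/-- Left trivialization `T_x G → 𝔤`: the derivative at `x` of left translation by `x⁻¹`. -/
def leftTriv (x : G) : E →L[ℝ] E :=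
  mfderiv 𝓘(ℝ, E) 𝓘(ℝ, E) (fun g : G => x⁻¹ * g) x

/-- An `Ad`-invariant inner product on the Lie algebra of `G`. -/
structure InvariantInner where
  form : LinearMap.BilinForm ℝ E
  symm : ∀ A B : E, form A B = form B A
  pos : ∀ A : E, A ≠ 0 → 0 < form A A
  ad_invariant : ∀ (x : G) (A B : E), form (Ad x A) (Ad x B) = form A B

/-- A torus in `G`: an injective smooth homomorphism from `(S¹)^r` to `G`. Smoothness is tested
after composition with the covering `ℝ^r → (S¹)^r`, `s ↦ (e^{i s_1}, …, e^{i s_r})`, which is a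
local diffeomorphism. -/
structure Torus (E : Type*) [NormedAddCommGroup E] [NormedSpace ℝ E]
    (G : Type*) [TopologicalSpace G] [ChartedSpace E G] [Group G] (r : ℕ) where
  hom : (Fin r → Circle) →* G
  injective : Function.Injective hom
  smooth : ContMDiff 𝓘(ℝ, Fin r → ℝ) 𝓘(ℝ, E) ∞
    (fun s : Fin r → ℝ => hom (fun k => Circle.exp (s k)))

variable {G} {r : ℕ}

/-- The subgroup `T` of `G`. -/
def Torus.subgroup (T : Torus E G r) : Subgroup G := T.hom.range

/-- `T` is a maximal torus: no torus of `G` properly contains it. -/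
def Torus.IsMaximal (T : Torus E G r) : Prop :=
  ∀ (r' : ℕ) (T' : Torus E G r'), T.subgroup ≤ T'.subgroup → T'.subgroup = T.subgroup

/-- The Lie algebra `𝔱 ⊆ 𝔤` of `T`. -/
def Torus.lieAlgebra (T : Torus E G r) : Submodule ℝ E :=
  LinearMap.range (ContinuousLinearMap.toLinearMap (M := Fin r → ℝ) (M₂ := E)
    (mfderiv 𝓘(ℝ, Fin r → ℝ) 𝓘(ℝ, E)
      (fun s : Fin r → ℝ => T.hom (fun k => Circle.exp (s k))) 0))

/-- The `T`-fiber `F_x` of `G → G / T` containing `x`. -/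
def Torus.fiber (T : Torus E G r) (x : G) : Set G :=
  {g | (QuotientGroup.mk g : G ⧸ T.subgroup) = QuotientGroup.mk x}

/-- `L_{(x,y)} = F_x × (y + 𝔱) ⊆ G × 𝔤 = T^*G`. -/
def Torus.leaf (T : Torus E G r) (x : G) (y : E) : Set (G × E) :=
  T.fiber x ×ˢ ((fun a => y + a) '' (T.lieAlgebra : Set E))

/-- The conditions on the linear map `F : 𝔤 → 𝔤`: self-adjoint, with image in `𝔱`, zero on `𝔱^⊥`,
positive definite on `𝔱`. -/
structure IsTorusQuadratic (B : InvariantInner (E := E) G) (T : Torus E G r) (F : E →ₗ[ℝ] E) :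
    Prop where
  selfAdjoint : ∀ A C : E, B.form (F A) C = B.form A (F C)
  image_le : ∀ A : E, F A ∈ T.lieAlgebra
  zero_of_orthogonal : ∀ A : E, (∀ C ∈ T.lieAlgebra, B.form A C = 0) → F A = 0
  pos : ∀ A ∈ T.lieAlgebra, A ≠ 0 → 0 < B.form A (F A)

/-- The Hamiltonian `f (x, y) = ½ ⟨y, F y⟩` on `T^*G = G × 𝔤`. -/
def hamiltonian (B : InvariantInner (E := E) G) (F : E →ₗ[ℝ] E) (p : G × E) : ℝ :=
  (1 / 2) * B.form p.2 (F p.2)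

end LieGroupSide

section CanonicalForm

variable {E : Type*} [NormedAddCommGroup E] [NormedSpace ℝ E] [FiniteDimensional ℝ E]
variable {G : Type*} [TopologicalSpace G] [ChartedSpace E G] [Group G]

theorem three_le : minSmoothness ℝ 3 ≤ (∞ : WithTop ℕ∞) := by
  rw [minSmoothness_of_isRCLikeNormedField]
  exact WithTop.coe_le_coe.2 le_top

theorem bracket_add_left [LieGroup 𝓘(ℝ, E) ∞ G] (U V W : E) :
    bracket G (U + V) W = bracket G U W + bracket G V W := by
  have : CompleteSpace E := FiniteDimensional.complete ℝ E
  have : LieGroup 𝓘(ℝ, E) (minSmoothness ℝ 3) G :=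
    LieGroup.of_le (n := ∞) three_le
  exact add_lie (L := GroupLieAlgebra 𝓘(ℝ, E) G) (M := GroupLieAlgebra 𝓘(ℝ, E) G) U V W

theorem bracket_self (U : E) : bracket G U U = 0 := by
  unfold bracket
  exact (GroupLieAlgebra.bracket_def (I := 𝓘(ℝ, E)) (G := G) U U).trans (by simp; rfl)

theorem bracket_add_right [LieGroup 𝓘(ℝ, E) ∞ G] (U V W : E) :
    bracket G U (V + W) = bracket G U V + bracket G U W := by
  have : CompleteSpace E := FiniteDimensional.complete ℝ E
  have : LieGroup 𝓘(ℝ, E) (minSmoothness ℝ 3) G :=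
    LieGroup.of_le (n := ∞) three_le
  exact lie_add (L := GroupLieAlgebra 𝓘(ℝ, E) G) (M := GroupLieAlgebra 𝓘(ℝ, E) G) U V W

theorem bracket_smul_left [LieGroup 𝓘(ℝ, E) ∞ G] (c : ℝ) (U W : E) :
    bracket G (c • U) W = c • bracket G U W := by
  have : CompleteSpace E := FiniteDimensional.complete ℝ E
  have : LieGroup 𝓘(ℝ, E) (minSmoothness ℝ 3) G :=
    LieGroup.of_le (n := ∞) three_le
  exact smul_lie (L := GroupLieAlgebra 𝓘(ℝ, E) G) (M := GroupLieAlgebra 𝓘(ℝ, E) G) c U W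

theorem bracket_smul_right [LieGroup 𝓘(ℝ, E) ∞ G] (c : ℝ) (U W : E) :
    bracket G U (c • W) = c • bracket G U W := by
  have : CompleteSpace E := FiniteDimensional.complete ℝ E
  have : LieGroup 𝓘(ℝ, E) (minSmoothness ℝ 3) G :=
    LieGroup.of_le (n := ∞) three_le
  exact lie_smul (L := GroupLieAlgebra 𝓘(ℝ, E) G) (M := GroupLieAlgebra 𝓘(ℝ, E) G) c U W

/-- The bilinear form `((U,V),(W,Z)) ↦ ⟨U,Z⟩ - ⟨V,W⟩ + ⟨y,[U,W]⟩` on `𝔤 ⊕ 𝔤`. -/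
def omegaBilin [LieGroup 𝓘(ℝ, E) ∞ G] (B : InvariantInner (E := E) G) (y : E) :
    LinearMap.BilinForm ℝ (E × E) :=
  LinearMap.mk₂ ℝ
    (fun X Y => B.form X.1 Y.2 - B.form X.2 Y.1 + B.form y (bracket G X.1 Y.1))
    (fun X X' Y => by simp [bracket_add_left]; ring)
    (fun c X Y => by simp [bracket_smul_left]; ring)
    (fun X Y Y' => by simp [bracket_add_right]; ring)
    (fun c X Y => by simp [bracket_smul_right]; ring)

/-- The canonical symplectic form `ω = -dθ` of `T^*G = G × 𝔤` at a point `(x, y)`, in the left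
trivialization `T_{(x,y)}(T^*G) = 𝔤 ⊕ 𝔤`:
`ω((U,V),(W,Z)) = ⟨U,Z⟩ - ⟨V,W⟩ + ⟨y,[U,W]⟩`. -/
def omegaTriv [LieGroup 𝓘(ℝ, E) ∞ G] (B : InvariantInner (E := E) G) (y : E) :
    (E × E) [⋀^Fin 2]→L[ℝ] ℝ where
  toFun m := omegaBilin B y (m 0) (m 1)
  map_update_add' m i u v := by
    rename_i inst
    cases Subsingleton.elim inst (instDecidableEqFin 2)
    fin_cases i <;> simp
  map_update_smul' m i c u := by
    rename_i inst
    cases Subsingleton.elim inst (instDecidableEqFin 2)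
    fin_cases i <;> simp
  map_eq_zero_of_eq' m i j h hij := by
    have h01 : m 0 = m 1 := by
      fin_cases i <;> fin_cases j <;> simp_all
    simp only [omegaBilin, LinearMap.mk₂_apply, h01, bracket_self, B.symm (m 1).1 (m 1).2]
    simp
  cont := by
    have h : Continuous fun X : E × E =>
        LinearMap.toContinuousLinearMap (omegaBilin (G := G) B y X) :=
      ((LinearMap.toContinuousLinearMap :
        ((E × E) →ₗ[ℝ] ℝ) ≃ₗ[ℝ] ((E × E) →L[ℝ] ℝ)).toLinearMap.comp
          (omegaBilin (G := G) B y)).continuous_of_finiteDimensional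
    exact (h.comp (continuous_apply 0)).clm_apply (continuous_apply 1)

/-- The identification `T_{(x,y)}(T^*G) → 𝔤 ⊕ 𝔤`. -/
def triv (p : G × E) : E × E →L[ℝ] E × E :=
  (leftTriv p.1).prodMap (ContinuousLinearMap.id ℝ E)

/-- The canonical symplectic form of `T^*G = G × 𝔤` on `T_p(T^*G)`. -/
def omega [LieGroup 𝓘(ℝ, E) ∞ G] (B : InvariantInner (E := E) G) (p : G × E) :
    (E × E) [⋀^Fin 2]→L[ℝ] ℝ :=
  (omegaTriv B p.2).compContinuousLinearMap (triv p)

end CanonicalForm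

section Polarization

variable {E : Type*} [NormedAddCommGroup E] [NormedSpace ℝ E]
variable {G : Type*} [TopologicalSpace G] [ChartedSpace E G] [Group G] {r : ℕ}

/-- `A ↦ (-σ̄ F A, A)`, from `𝔤_ℂ` to `𝔤_ℂ ⊕ 𝔤_ℂ = (𝔤 ⊕ 𝔤) ⊗ ℂ`. -/
def polMap (σ : ℂ) (F : E →ₗ[ℝ] E) : (ℂ ⊗[ℝ] E) →ₗ[ℂ] (ℂ ⊗[ℝ] E) × (ℂ ⊗[ℝ] E) :=
  ((-(starRingEnd ℂ σ)) • F.baseChange ℂ).prod LinearMap.id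

/-- The mixed polarization `P_{0,σ} = {(-σ̄ F A, A) | A ∈ 𝔤_ℂ}` of `T^*G`; in the left trivialization
it is the same subspace of `(𝔤 ⊕ 𝔤) ⊗ ℂ` at all points. -/
def mixedPolarization (σ : ℂ) (F : E →ₗ[ℝ] E) :
    Submodule ℂ ((ℂ ⊗[ℝ] E) × (ℂ ⊗[ℝ] E)) :=
  LinearMap.range (polMap σ F)

/-- The `𝔱`-part `P_{0,σ}^𝔱` of `P_{0,σ}`: its vectors with both components in `𝔱_ℂ`. -/
def tPart (T : Torus E G r) (σ : ℂ) (F : E →ₗ[ℝ] E) :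
    Submodule ℂ ((ℂ ⊗[ℝ] E) × (ℂ ⊗[ℝ] E)) :=
  mixedPolarization σ F ⊓
    Submodule.prod (T.lieAlgebra.baseChange ℂ) (T.lieAlgebra.baseChange ℂ)

/-- The complex vector `X + i Y`, for `X, Y ∈ 𝔤 ⊕ 𝔤`. -/
def cplx (X Y : E × E) : (ℂ ⊗[ℝ] E) × (ℂ ⊗[ℝ] E) :=
  ((1 : ℂ) ⊗ₜ[ℝ] X.1 + Complex.I ⊗ₜ[ℝ] Y.1, (1 : ℂ) ⊗ₜ[ℝ] X.2 + Complex.I ⊗ₜ[ℝ] Y.2)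

/-- The real distribution on `T^*G` (in the left trivialization) underlying a complex distribution
`P`: the real parts of the vectors of `P`. As `P` is stable under multiplication by `i`, this is
`Re P + Im P`, the real vectors in `P + P̄`. -/
def realDistribution (P : Submodule ℂ ((ℂ ⊗[ℝ] E) × (ℂ ⊗[ℝ] E))) : Set (E × E) :=
  {X | ∃ Y, cplx X Y ∈ P}

/-- The leaf through `p` of a real distribution on `G × 𝔤` given by a subset `S` of `𝔤 ⊕ 𝔤` in the
left trivialization: all points that can be reached from `p` along a smooth curve tangent to the
distribution. -/
def leafThrough (S : Set (E × E)) (p : G × E) : Set (G × E) :=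
  {q | ∃ γ : ℝ → G × E, ContMDiff 𝓘(ℝ, ℝ) (𝓘(ℝ, E).prod 𝓘(ℝ, E)) ∞ γ ∧ γ 0 = p ∧ γ 1 = q ∧
    ∀ s : ℝ, triv (γ s)
      ((mfderiv 𝓘(ℝ, ℝ) (𝓘(ℝ, E).prod 𝓘(ℝ, E)) γ s : ℝ →L[ℝ] E × E) 1) ∈ S}

end Polarization

section Kahler

variable {V : Type*} [NormedAddCommGroup V] [NormedSpace ℂ V]
variable {M : Type*} [TopologicalSpace M] [ChartedSpace V M]

/-- The local expression in a chart `e` of a real `2`-form `Ω` on a complex manifold `M`. -/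
def chartForm (Ω : M → V [⋀^Fin 2]→L[ℝ] ℝ) (e : OpenPartialHomeomorph M V) (z : V) :
    V [⋀^Fin 2]→L[ℝ] ℝ :=
  (Ω (e.symm z)).compContinuousLinearMap
    (mfderiv 𝓘(ℝ, V) 𝓘(ℝ, V) e.symm z : V →L[ℝ] V)

/-- `Ω` is a Kähler form on the complex manifold `M`: a smooth closed real `2`-form that is
invariant under the complex structure `J` (multiplication by `i` on the tangent spaces) and
satisfies `Ω(v, Jv) > 0` for `v ≠ 0`. -/
structure IsKahlerForm (Ω : M → V [⋀^Fin 2]→L[ℝ] ℝ) : Prop where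
  smooth : ∀ e ∈ atlas V M, ContDiffOn ℝ ∞ (chartForm Ω e) e.target
  closed : ∀ e ∈ atlas V M, ∀ z ∈ e.target, extDeriv (chartForm Ω e) z = 0
  invariant : ∀ (p : M) (v w : V), Ω p ![Complex.I • v, Complex.I • w] = Ω p ![v, w]
  positive : ∀ (p : M) (v : V), v ≠ 0 → 0 < Ω p ![v, Complex.I • v]

/-- `(i ∂∂̄ u)_z (v, w)` for a real function `u` on a complex vector space. As
`i ∂∂̄ u = -½ d(du ∘ J)`, it equals `½ (D²u(w, i v) - D²u(v, i w))`. -/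
def iddbar (u : V → ℝ) (z v w : V) : ℝ :=
  (1 / 2) * (fderiv ℝ (fderiv ℝ u) z w (Complex.I • v) -
    fderiv ℝ (fderiv ℝ u) z v (Complex.I • w))

/-- `κ` is a global Kähler potential of `Ω`: it is smooth and `Ω = i ∂∂̄ κ`. -/
structure IsKahlerPotential (Ω : M → V [⋀^Fin 2]→L[ℝ] ℝ) (κ : M → ℝ) : Prop where
  smooth : ContMDiff 𝓘(ℝ, V) 𝓘(ℝ, ℝ) ∞ κ
  eq_iddbar : ∀ e ∈ atlas V M, ∀ z ∈ e.target, ∀ v w : V,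
    chartForm Ω e z ![v, w] = iddbar (fun z' => κ (e.symm z')) z v w

/-- The complexification `(ℂ^*)^r` of the torus `(S¹)^r`, as an open subset of `ℂ^r`. -/
def complexTorus (r : ℕ) : TopologicalSpace.Opens (Fin r → ℂ) :=
  ⟨{z | ∀ k, z k ≠ 0}, by
    simp only [Set.ofPred_forall]
    exact isOpen_iInter_of_finite fun k => isOpen_ne_fun (continuous_apply k) continuous_const⟩

end Kahler

section Leaf

variable {E : Type*} [NormedAddCommGroup E] [NormedSpace ℝ E]
variable {G : Type*} [TopologicalSpace G] [ChartedSpace E G]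
variable {V : Type*} [NormedAddCommGroup V] [NormedSpace ℂ V]

/-- The differential at `p` of the inclusion `ι : L → T^*G` of a subset with a (complex) manifold
structure. -/
def dIncl (L : Set (G × E)) [ChartedSpace V L] (p : L) : V →L[ℝ] E × E :=
  mfderiv 𝓘(ℝ, V) (𝓘(ℝ, E).prod 𝓘(ℝ, E)) (Subtype.val : L → G × E) p

/-- The pull-back `ι^* ω` of the canonical symplectic form. -/
def pullbackOmega [FiniteDimensional ℝ E] [Group G] [LieGroup 𝓘(ℝ, E) ∞ G]
    (B : InvariantInner (E := E) G) (L : Set (G × E)) [ChartedSpace V L] (p : L) :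
    V [⋀^Fin 2]→L[ℝ] ℝ :=
  (omega B p.1).compContinuousLinearMap (dIncl (V := V) L p)

/-- The holomorphic tangent space `T^{(1,0)}_p L = {v - i J v}`, seen inside `(𝔤 ⊕ 𝔤) ⊗ ℂ` through
the complexified differential of the inclusion and the left trivialization. -/
def holTangent [Group G] (L : Set (G × E)) [ChartedSpace V L] (p : L) :
    Set ((ℂ ⊗[ℝ] E) × (ℂ ⊗[ℝ] E)) :=
  Set.range fun v : V => 
    cplx (triv p.1 (dIncl (V := V) L p v)) (-triv p.1 (dIncl (V := V) L p (Complex.I • v)))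

/-- `L ⊆ T^*G`, with the subspace topology and the given complex charts, is a complex manifold that
is a smoothly embedded submanifold of `T^*G`. -/
structure IsEmbeddedComplexManifold (L : Set (G × E)) [ChartedSpace V L] : Prop where
  isManifold : IsManifold 𝓘(ℂ, V) ω L
  smooth : ContMDiff 𝓘(ℝ, V) (𝓘(ℝ, E).prod 𝓘(ℝ, E)) ∞ (Subtype.val : L → G × E)
  immersion : ∀ p : L, Function.Injective (dIncl (V := V) L p)

end Leaf

end KahlerLeaves

end

/-! Positivity makes `F` an automorphism of 𝔱, so there is a linear isomorphism `K` from ℝ^r onto 𝔱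
with `F ∘ K = dexp`, the differential of the exponential map of the torus
(`IsTorusQuadratic.nonempty_section`). The whole proof rests on the parametrization ξ ↦ (x exp(Im ξ
+ (σ₁/σ₂) Re ξ), y - σ₂⁻¹ K(Re ξ)), ξ ∈ ℂ^r. It is invariant under 2πi ℤ^r and descends along z =
e^ξ to a homeomorphism from (ℂ^*)^r onto the leaf (`TorusSection.leafHomeomorph`). The complex
structure is transported along it, so the biholomorphism is built in; right translation by T shifts
Im ξ, which gives equivariance.

The remaining claims are linear algebra in ξ. In the left trivialization the tangent map is the
constant map `leafTangent`, and its (1,0)-vectors are (-σ̄FA, A) with A = -σ₂⁻¹(K Re ξ + i K Im ξ)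
(`cplx_leafTangent`). The bracket vanishes on 𝔱 (`Torus.bracket_dexp`), so ω pulls back to a
constant, hence closed, form: σ₂⁻¹ times the standard Kähler form of the inner product ⟨Ku, FKv⟩
(`TorusSection.leafForm_apply`). The function 2σ₂f is a quadratic polynomial in Re ξ, and its i∂∂̄
is that form (`TorusSection.iddbar_hamiltonian`). Local branches of the logarithm carry these facts
to the coordinate z.

For the leaf property, the real parts of the polarization fill 𝔱 ⊕ 𝔱 because σ₂ ≠ 0
(`realDistribution_tPart`). A curve whose left logarithmic derivative lies in 𝔱 stays in a coset of
T: correcting it by the exponential of a primitive leaves a curve with zero derivative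
(`Torus.exists_eq_mul_exp`). -/

noncomputable section

namespace KahlerLeaves

/-! ### Calculus of manifold derivatives as maps between model spaces -/

section Differential

variable {E E' E'' : Type*} [NormedAddCommGroup E] [NormedSpace ℝ E]
  [NormedAddCommGroup E'] [NormedSpace ℝ E'] [NormedAddCommGroup E''] [NormedSpace ℝ E'']
variable {H H' H'' : Type*} [TopologicalSpace H] [TopologicalSpace H'] [TopologicalSpace H'']
  {I : ModelWithCorners ℝ E H} {I' : ModelWithCorners ℝ E' H'} {I'' : ModelWithCorners ℝ E'' H''}
variable {M M' M'' : Type*} [TopologicalSpace M] [ChartedSpace H M] [TopologicalSpace M']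
  [ChartedSpace H' M'] [TopologicalSpace M''] [ChartedSpace H'' M'']

/-- `HasMFDerivAt`, with the tangent spaces replaced by the model vector spaces. -/
def HasDifferential (I : ModelWithCorners ℝ E H) (I' : ModelWithCorners ℝ E' H') (f : M → M')
    (x : M) (f' : E →L[ℝ] E') : Prop :=
  HasMFDerivAt I I' f x f'

/-- `mfderiv`, with the tangent spaces replaced by the model vector spaces. -/
def differential (I : ModelWithCorners ℝ E H) (I' : ModelWithCorners ℝ E' H') (f : M → M')
    (x : M) : E →L[ℝ] E' :=
  mfderiv I I' f x

theorem MDifferentiableAt.hasDifferential {f : M → M'} {x : M}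
    (h : MDifferentiableAt I I' f x) : HasDifferential I I' f x (differential I I' f x) :=
  h.hasMFDerivAt

theorem HasDifferential.differential_eq {f : M → M'} {x : M} {f' : E →L[ℝ] E'}
    (h : HasDifferential I I' f x f') : differential I I' f x = f' :=
  HasMFDerivAt.mfderiv h

theorem HasDifferential.unique {f : M → M'} {x : M} {f' f'' : E →L[ℝ] E'}
    (h : HasDifferential I I' f x f') (h' : HasDifferential I I' f x f'') : f' = f'' :=
  h.differential_eq.symm.trans h'.differential_eq

theorem HasDifferential.comp {g : M' → M''} {f : M → M'} {x : M} {y : M'}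
    {g' : E' →L[ℝ] E''} {f' : E →L[ℝ] E'} (hg : HasDifferential I' I'' g y g')
    (hf : HasDifferential I I' f x f') (hy : f x = y) :
    HasDifferential I I'' (fun z => g (f z)) x (g'.comp f') := by
  subst hy
  exact HasMFDerivAt.comp x hg hf

theorem HasDifferential.congr {f g : M → M'} {x : M} {f' : E →L[ℝ] E'}
    (h : HasDifferential I I' f x f') (hfg : g =ᶠ[nhds x] f) : HasDifferential I I' g x f' :=
  HasMFDerivAt.congr_of_eventuallyEq h hfg

theorem HasDifferential.continuousAt {f : M → M'} {x : M} {f' : E →L[ℝ] E'}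
    (h : HasDifferential I I' f x f') : ContinuousAt f x :=
  HasMFDerivAt.continuousAt h

theorem HasDifferential.prodMk {f : M → M'} {g : M → M''} {x : M} {f' : E →L[ℝ] E'}
    {g' : E →L[ℝ] E''} (hf : HasDifferential I I' f x f') (hg : HasDifferential I I'' g x g') :
    HasDifferential I (I'.prod I'') (fun z => (f z, g z)) x (f'.prod g') :=
  HasMFDerivAt.prodMk hf hg

theorem HasDifferential.fst {f : M → M' × M''} {x : M} {f' : E →L[ℝ] E' × E''}
    (hf : HasDifferential I (I'.prod I'') f x f') :
    HasDifferential I I' (fun z => (f z).1) x ((ContinuousLinearMap.fst ℝ E' E'').comp f') :=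
  HasDifferential.comp (I' := I'.prod I'') (g := Prod.fst)
    (hasMFDerivAt_fst (I := I') (I' := I'') (f x)) hf rfl

theorem HasDifferential.snd {f : M → M' × M''} {x : M} {f' : E →L[ℝ] E' × E''}
    (hf : HasDifferential I (I'.prod I'') f x f') :
    HasDifferential I I'' (fun z => (f z).2) x ((ContinuousLinearMap.snd ℝ E' E'').comp f') :=
  HasDifferential.comp (I' := I'.prod I'') (g := Prod.snd)
    (hasMFDerivAt_snd (I := I') (I' := I'') (f x)) hf rfl

theorem HasDifferential.id (x : M) :
    HasDifferential I I (fun z : M => z) x (ContinuousLinearMap.id ℝ E) :=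
  hasMFDerivAt_id x

theorem hasDifferential_const (c : M') (x : M) :
    HasDifferential I I' (fun _ : M => c) x (0 : E →L[ℝ] E') :=
  hasMFDerivAt_const c x

theorem hasDifferential_iff_hasFDerivAt {f : E → E'} {x : E} {f' : E →L[ℝ] E'} :
    HasDifferential 𝓘(ℝ, E) 𝓘(ℝ, E') f x f' ↔ HasFDerivAt f f' x :=
  hasMFDerivAt_iff_hasFDerivAt

/-- A curve with zero derivative in a manifold is constant. -/
theorem eq_of_hasDifferential_zero {M : Type*} [TopologicalSpace M] [ChartedSpace E M]
    [IsManifold 𝓘(ℝ, E) 1 M] {γ : ℝ → M}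
    (h : ∀ s, HasDifferential 𝓘(ℝ, ℝ) 𝓘(ℝ, E) γ s 0) (s t : ℝ) : γ s = γ t := by
  have hc : Continuous γ := continuous_iff_continuousAt.2 fun s => (h s).continuousAt
  have key : ∀ s, ∃ U : Set ℝ, IsOpen U ∧ s ∈ U ∧ ∀ t ∈ U, γ t = γ s := by
    intro s
    -- Local constancy is checked on a ball that γ maps into one chart; connectedness of ℝ then
    -- globalizes it.
    let φ := extChartAt 𝓘(ℝ, E) (γ s)
    have hU : γ ⁻¹' φ.source ∈ nhds s :=
      hc.continuousAt.preimage_mem_nhds (extChartAt_source_mem_nhds _)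
    obtain ⟨ε, hε, hb⟩ := Metric.mem_nhds_iff.1 hU
    refine ⟨Metric.ball s ε, Metric.isOpen_ball, Metric.mem_ball_self hε, fun t ht => ?_⟩
    have hd : ∀ u ∈ Metric.ball s ε, HasFDerivAt (fun u => φ (γ u)) (0 : ℝ →L[ℝ] E) u := by
      intro u hu
      have h1 : MDifferentiableAt 𝓘(ℝ, E) 𝓘(ℝ, E) φ (γ u) :=
        mdifferentiableAt_extChartAt (by simpa [φ] using hb hu)
      have h2 := (MDifferentiableAt.hasDifferential h1).comp (h u) rfl
      rw [ContinuousLinearMap.comp_zero] at h2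
      exact hasDifferential_iff_hasFDerivAt.1 h2
    have := (convex_ball s ε).is_const_of_fderivWithin_eq_zero (𝕜 := ℝ)
      (f := fun u => φ (γ u)) (fun u hu => (hd u hu).differentiableAt.differentiableWithinAt)
      (fun u hu => by
        rw [fderivWithin_of_isOpen Metric.isOpen_ball hu]
        exact (hd u hu).fderiv) ht (Metric.mem_ball_self hε)
    exact φ.injOn (hb ht) (hb (Metric.mem_ball_self hε)) this
  exact IsLocallyConstant.apply_eq_of_isPreconnected
    ((IsLocallyConstant.iff_exists_open γ).2 key) isPreconnected_univ
    (Set.mem_univ s) (Set.mem_univ t)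

end Differential

/-! ### The exponential map of a torus and its differential -/

section TorusExp

variable {E : Type*} [NormedAddCommGroup E] [NormedSpace ℝ E]
variable {G : Type*} [TopologicalSpace G] [ChartedSpace E G] [Group G] {r : ℕ}

/-- The exponential map `ℝ^r → G` of a torus. -/
def Torus.exp (T : Torus E G r) (s : Fin r → ℝ) : G :=
  T.hom fun k => Circle.exp (s k)

/-- The differential at `0` of the exponential map of a torus. -/
def Torus.dexp (T : Torus E G r) : (Fin r → ℝ) →L[ℝ] E :=
  differential 𝓘(ℝ, Fin r → ℝ) 𝓘(ℝ, E) T.exp 0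

/-- The differential at `1` of left translation by `g`. -/
def leftTransl (g : G) : E →L[ℝ] E :=
  differential 𝓘(ℝ, E) 𝓘(ℝ, E) (fun h : G => g * h) 1

variable (T : Torus E G r)

theorem Torus.exp_zero : T.exp 0 = 1 := by
  simp only [Torus.exp, Pi.zero_apply, Circle.exp_zero]
  exact T.hom.map_one

theorem Torus.exp_add (s t : Fin r → ℝ) : T.exp (s + t) = T.exp s * T.exp t := by
  simp only [Torus.exp, Pi.add_apply, Circle.exp_add, ← map_mul]
  rfl

theorem Torus.exp_mem (s : Fin r → ℝ) : T.exp s ∈ T.subgroup := ⟨_, rfl⟩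

theorem Torus.exists_exp_eq (t : Fin r → Circle) : ∃ s, T.exp s = T.hom t := by
  choose s hs using fun k => Circle.exp_surjective (t k)
  exact ⟨s, by simp only [Torus.exp, hs]⟩

theorem Torus.mem_subgroup_iff {g : G} : g ∈ T.subgroup ↔ ∃ s, T.exp s = g := by
  constructor
  · rintro ⟨t, rfl⟩
    exact T.exists_exp_eq t
  · rintro ⟨s, rfl⟩
    exact T.exp_mem s

theorem Torus.mem_lieAlgebra_iff {A : E} : A ∈ T.lieAlgebra ↔ ∃ s, T.dexp s = A := Iff.rfl

theorem Torus.dexp_mem (s : Fin r → ℝ) : T.dexp s ∈ T.lieAlgebra := ⟨s, rfl⟩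

theorem Torus.mem_fiber_iff {x g : G} : g ∈ T.fiber x ↔ ∃ s, g = x * T.exp s := by
  rw [Torus.fiber, Set.mem_ofPred_eq, eq_comm, QuotientGroup.eq, T.mem_subgroup_iff]
  exact exists_congr fun s => by rw [eq_comm, inv_mul_eq_iff_eq_mul]

theorem Torus.contMDiff_exp : ContMDiff 𝓘(ℝ, Fin r → ℝ) 𝓘(ℝ, E) ∞ T.exp := T.smooth

theorem Torus.mdifferentiableAt_exp (s : Fin r → ℝ) :
    MDifferentiableAt 𝓘(ℝ, Fin r → ℝ) 𝓘(ℝ, E) T.exp s :=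
  ContMDiff.mdifferentiableAt T.smooth (by simp)

theorem isManifold_one [LieGroup 𝓘(ℝ, E) ∞ G] : IsManifold 𝓘(ℝ, E) 1 G :=
  IsManifold.of_le (n := ∞) (by simp)

variable [LieGroup 𝓘(ℝ, E) ∞ G]

theorem mdifferentiableAt_const_mul (g h : G) :
    MDifferentiableAt 𝓘(ℝ, E) 𝓘(ℝ, E) (fun h : G => g * h) h :=
  (contMDiff_mul_left (I := 𝓘(ℝ, E)) (n := ∞)).mdifferentiableAt (by simp)

theorem hasDifferential_const_mul_one (g : G) :
    HasDifferential 𝓘(ℝ, E) 𝓘(ℝ, E) (fun h : G => g * h) 1 (leftTransl g) :=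
  MDifferentiableAt.hasDifferential (mdifferentiableAt_const_mul g 1)

theorem hasDifferential_inv_mul_self (g : G) :
    HasDifferential 𝓘(ℝ, E) 𝓘(ℝ, E) (fun h : G => g⁻¹ * h) g (leftTriv g) :=
  MDifferentiableAt.hasDifferential (mdifferentiableAt_const_mul g⁻¹ g)

theorem leftTriv_leftTransl (g : G) (v : E) : leftTriv g (leftTransl g v) = v := by
  have h := (hasDifferential_inv_mul_self (E := E) g).comp (hasDifferential_const_mul_one g)
    (mul_one g)
  simp only [inv_mul_cancel_left] at h
  exact DFunLike.congr_fun (h.unique (HasDifferential.id 1)) v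

theorem leftTransl_leftTriv (g : G) (v : E) : leftTransl g (leftTriv g v) = v := by
  have h := (hasDifferential_const_mul_one (E := E) g).comp (hasDifferential_inv_mul_self g)
    (inv_mul_cancel g)
  simp only [mul_inv_cancel_left] at h
  exact DFunLike.congr_fun (h.unique (HasDifferential.id g)) v

/-- The differential of the exponential map of a torus, translated by an element `g`. -/
theorem Torus.hasDifferential_mul_exp (g : G) (s : Fin r → ℝ) :
    HasDifferential 𝓘(ℝ, Fin r → ℝ) 𝓘(ℝ, E) (fun t => g * T.exp t) s
      ((leftTransl (g * T.exp s)).comp T.dexp) := by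
  -- Writing g exp(t) = (g exp(s)) exp(t - s) reduces the derivative at `s` to the derivative at 0.
  have h1 : HasDifferential 𝓘(ℝ, Fin r → ℝ) 𝓘(ℝ, Fin r → ℝ) (fun t => t - s) s
      (ContinuousLinearMap.id ℝ (Fin r → ℝ)) :=
    hasDifferential_iff_hasFDerivAt.2 ((hasFDerivAt_id s).sub_const s)
  have h2 : HasDifferential 𝓘(ℝ, Fin r → ℝ) 𝓘(ℝ, E) T.exp 0 T.dexp :=
    MDifferentiableAt.hasDifferential (T.mdifferentiableAt_exp 0)
  have h4 := (hasDifferential_const_mul_one (g * T.exp s)).comp (h2.comp h1 (sub_self s))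
    (by rw [sub_self, T.exp_zero])
  simp only [mul_assoc, ← T.exp_add, add_sub_cancel] at h4
  rw [ContinuousLinearMap.comp_id] at h4
  exact h4

/-- If `dexp v = 0`, the curve u ↦ exp(uv) has zero derivative everywhere, so it is constantly 1.
Injectivity of the homomorphism gives e^{iuv_k} = 1 for all u, and differentiating at u = 0 gives
v_k = 0. -/
theorem Torus.dexp_injective : Function.Injective T.dexp := by
  have := isManifold_one (E := E) (G := G)
  rw [injective_iff_map_eq_zero]
  intro v hv
  have hd : ∀ u : ℝ, HasDifferential 𝓘(ℝ, ℝ) 𝓘(ℝ, E) (fun u : ℝ => 1 * T.exp (u • v)) u 0 := by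
    intro u
    have h1 : HasDifferential 𝓘(ℝ, ℝ) 𝓘(ℝ, Fin r → ℝ) (fun u : ℝ => u • v) u
        (ContinuousLinearMap.toSpanSingleton ℝ v) :=
      hasDifferential_iff_hasFDerivAt.2 (ContinuousLinearMap.toSpanSingleton ℝ v).hasFDerivAt
    have h2 := (T.hasDifferential_mul_exp 1 (u • v)).comp h1 rfl
    convert h2 using 1
    refine ContinuousLinearMap.ext_ring ?_
    simp [hv]
  have hconst : ∀ u : ℝ, T.exp (u • v) = 1 := by
    intro u
    have := eq_of_hasDifferential_zero hd u 0
    simpa [T.exp_zero] using this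
  have hcirc : ∀ (u : ℝ) k, Circle.exp (u * v k) = 1 := by
    intro u k
    have h1 := hconst u
    rw [Torus.exp] at h1
    exact congr_fun (T.injective (h1.trans T.hom.map_one.symm)) k
  funext k
  have h1 : ∀ u : ℝ, HasDerivAt (fun u : ℝ => Complex.exp ((u * v k : ℝ) * Complex.I))
      (Complex.exp ((u * v k : ℝ) * Complex.I) * ((v k : ℝ) * Complex.I)) u := by
    intro u
    have := ((((hasDerivAt_id u).mul_const (v k)).ofReal_comp).mul_const Complex.I).cexp
    simpa using this
  have h2 : (fun u : ℝ => Complex.exp ((u * v k : ℝ) * Complex.I)) = fun _ => 1 := by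
    funext u
    have := congr_arg (fun z : Circle => (z : ℂ)) (hcirc u k)
    simpa only [Circle.coe_exp, Circle.coe_one] using this
  have h3 := h1 0
  rw [h2] at h3
  have h4 := h3.unique (hasDerivAt_const 0 1)
  simpa using h4

end TorusExp

/-! ### Vanishing of the Lie bracket on 𝔱 -/

section Commute

/-- If two vector fields are related to constant vector fields by a map `c`, then their Lie bracket
vanishes along `c`. -/
theorem lieBracket_eq_zero_of_related_const {E F : Type*} [NormedAddCommGroup E] [NormedSpace ℝ E]
    [NormedAddCommGroup F] [NormedSpace ℝ F] {c : F → E} {x u w : F} {V W : E → E}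
    {t : Set E} (ht : t = Set.univ) (hc : ContDiffAt ℝ 2 c x)
    (hV : DifferentiableAt ℝ V (c x)) (hW : DifferentiableAt ℝ W (c x))
    (hVc : ∀ᶠ s in nhds x, V (c s) = fderiv ℝ c s u)
    (hWc : ∀ᶠ s in nhds x, W (c s) = fderiv ℝ c s w) :
    VectorField.lieBracketWithin ℝ V W t (c x) = 0 := by
  subst ht
  have hc1 : DifferentiableAt ℝ c x := hc.differentiableAt (by simp)
  have hc2 : DifferentiableAt ℝ (fderiv ℝ c) x :=
    (hc.fderiv_right (m := 1) (by norm_num)).differentiableAt (by simp)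
  -- Differentiating V(c(s)) = Dc(s)u in the direction v gives DV(Dc v) = D²c(v, u). The bracket is
  -- therefore a difference of two values of D²c, which cancel by symmetry.
  have key : ∀ {V : E → E} {u : F}, DifferentiableAt ℝ V (c x) →
      (∀ᶠ s in nhds x, V (c s) = fderiv ℝ c s u) → ∀ v : F,
      fderiv ℝ V (c x) (fderiv ℝ c x v) = fderiv ℝ (fderiv ℝ c) x v u := by
    intro V u hV hVc v
    have h1 := hV.hasFDerivAt.comp x hc1.hasFDerivAt
    have h2 : HasFDerivAt (fun s => fderiv ℝ c s u) _ x :=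
      hc2.hasFDerivAt.clm_apply (hasFDerivAt_const u x)
    have h3 := h1.unique (h2.congr_of_eventuallyEq hVc)
    have h4 := DFunLike.congr_fun h3 v
    simpa using h4
  rw [VectorField.lieBracketWithin_univ, VectorField.lieBracket_eq]
  simp only
  rw [hVc.self_of_nhds, hWc.self_of_nhds, key hW hWc, key hV hVc,
    (hc.isSymmSndFDerivAt (by simp)).eq, sub_self]

variable {E : Type*} [NormedAddCommGroup E] [NormedSpace ℝ E]
variable {G : Type*} [TopologicalSpace G] [ChartedSpace E G] [Group G] {r : ℕ}
variable [LieGroup 𝓘(ℝ, E) ∞ G] (T : Torus E G r)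

/-- The left-invariant field of `dexp u` is related by `exp` to the constant field `u` on ℝ^r, and
constant fields commute. The computation takes place in the chart at 1, where the bracket of
`GroupLieAlgebra` is evaluated. -/
theorem Torus.bracket_dexp [CompleteSpace E] (u w : Fin r → ℝ) :
    bracket G (T.dexp u) (T.dexp w) = 0 := by
  have hm : IsManifold 𝓘(ℝ, E) 1 G := isManifold_one
  have hm2 : IsManifold 𝓘(ℝ, E) 2 G := IsManifold.of_le (n := ∞) (WithTop.coe_le_coe.2 le_top)
  have hm3 : IsManifold 𝓘(ℝ, E) ∞ G := inferInstance
  have hL : LieGroup 𝓘(ℝ, E) (minSmoothness ℝ 3) G := LieGroup.of_le (n := ∞) three_le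
  let φ := extChartAt 𝓘(ℝ, E) (1 : G)
  let c : (Fin r → ℝ) → E := fun s => φ (T.exp s)
  have hc0 : c 0 = φ 1 := by simp only [c, T.exp_zero]
  have hcont : Continuous T.exp := ContMDiff.continuous T.smooth
  have hsrc : ∀ᶠ s in nhds (0 : Fin r → ℝ), T.exp s ∈ φ.source := by
    refine hcont.continuousAt.preimage_mem_nhds ?_
    rw [T.exp_zero]
    exact extChartAt_source_mem_nhds _
  have hc : ContDiffAt ℝ 2 c 0 := by
    have h1 : ContMDiffAt 𝓘(ℝ, E) 𝓘(ℝ, E) ∞ φ (T.exp 0) := by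
      rw [T.exp_zero]
      exact contMDiffAt_extChartAt
    have h2 : ContMDiffAt 𝓘(ℝ, Fin r → ℝ) 𝓘(ℝ, E) ∞ c 0 :=
      ContMDiffAt.comp 0 h1 (ContMDiff.contMDiffAt T.smooth)
    exact h2.contDiffAt.of_le (WithTop.coe_le_coe.2 le_top)
  -- In the chart, the invariant field at `c s` is `Dc(s) u`; this only makes sense while `exp s`
  -- stays in the chart domain, hence for `s` near 0.
  have rel : ∀ u : Fin r → ℝ, ∀ᶠ s in nhds (0 : Fin r → ℝ),
      (VectorField.mpullbackWithin 𝓘(ℝ, E) 𝓘(ℝ, E) φ.symm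
        (mulInvariantVectorField (I := 𝓘(ℝ, E)) (G := G) (T.dexp u)) (Set.range 𝓘(ℝ, E)) (c s) : E)
        = fderiv ℝ c s u := by
    intro u
    filter_upwards [hsrc.eventually_nhds] with s hs
    have hs0 : T.exp s ∈ φ.source := hs.self_of_nhds
    have hback : φ.symm (c s) = T.exp s := φ.left_inv hs0
    have htgt : c s ∈ φ.target := φ.map_source hs0
    have hdφ : HasDifferential 𝓘(ℝ, E) 𝓘(ℝ, E) φ (T.exp s)
        (differential 𝓘(ℝ, E) 𝓘(ℝ, E) φ (T.exp s)) :=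
      MDifferentiableAt.hasDifferential (mdifferentiableAt_extChartAt (by simpa [φ] using hs0))
    have hexp := T.hasDifferential_mul_exp 1 s
    simp only [one_mul] at hexp
    have hdc : HasFDerivAt c (fderiv ℝ c s) s :=
      (hasDifferential_iff_hasFDerivAt.1 (hdφ.comp hexp rfl)).differentiableAt.hasFDerivAt
    have hinv := isInvertible_mfderivWithin_extChartAt_symm (I := 𝓘(ℝ, E)) (x := (1 : G)) htgt
    have hsymm : HasDifferential 𝓘(ℝ, E) 𝓘(ℝ, E) φ.symm (c s)
        (mfderivWithin 𝓘(ℝ, E) 𝓘(ℝ, E) φ.symm (Set.range 𝓘(ℝ, E)) (c s)) := by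
      have h1 := (mdifferentiableWithinAt_extChartAt_symm (I := 𝓘(ℝ, E)) htgt).hasMFDerivWithinAt
      have h2 : HasMFDerivWithinAt 𝓘(ℝ, E) 𝓘(ℝ, E) φ.symm Set.univ (c s)
        (mfderivWithin 𝓘(ℝ, E) 𝓘(ℝ, E) φ.symm (Set.range 𝓘(ℝ, E)) (c s)) := by
        convert h1 using 1
        simp
      exact hasMFDerivWithinAt_univ.1 h2
    have h2 := (hsymm.comp (hasDifferential_iff_hasFDerivAt.2 hdc) rfl).congr (g := T.exp) (by
      filter_upwards [hs] with t ht
      exact (φ.left_inv ht).symm)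
    have h3 := DFunLike.congr_fun (hexp.unique h2) u
    have h4 : mulInvariantVectorField (I := 𝓘(ℝ, E)) (G := G) (T.dexp u) (φ.symm (c s)) =
        (mfderivWithin 𝓘(ℝ, E) 𝓘(ℝ, E) φ.symm (Set.range 𝓘(ℝ, E)) (c s) : E →L[ℝ] E)
          (fderiv ℝ c s u) := by
      rw [hback]
      exact h3
    rw [VectorField.mpullbackWithin_apply]
    refine (congr_arg _ h4).trans ?_
    exact hinv.inverse_apply_eq.2 rfl
  have diff : ∀ u : Fin r → ℝ, DifferentiableAt ℝ
      (VectorField.mpullbackWithin 𝓘(ℝ, E) 𝓘(ℝ, E) φ.symm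
        (mulInvariantVectorField (I := 𝓘(ℝ, E)) (G := G) (T.dexp u)) (Set.range 𝓘(ℝ, E)) : E → E)
      (c 0) := by
    intro u
    have h1 := MDifferentiableWithinAt.differentiableWithinAt_mpullbackWithin_vectorField
      (mdifferentiableAt_mulInvariantVectorField (I := 𝓘(ℝ, E)) (G := G) (T.dexp u)
        (g := 1)).mdifferentiableWithinAt (s := Set.univ)
    simp only [Set.preimage_univ, Set.univ_inter, ModelWithCorners.range_eq_univ] at h1
    rw [hc0]
    simpa only [ModelWithCorners.range_eq_univ] using h1.differentiableAt Filter.univ_mem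
  have hset : φ.symm ⁻¹' Set.univ ∩ Set.range 𝓘(ℝ, E) = Set.univ := by simp
  have key := lieBracket_eq_zero_of_related_const hset hc (diff u) (diff w) (rel u) (rel w)
  rw [hc0] at key
  refine (GroupLieAlgebra.bracket_def (I := 𝓘(ℝ, E)) (G := G) _ _).trans ?_
  refine (congr_fun VectorField.mlieBracketWithin_univ.symm _).trans ?_
  refine VectorField.mlieBracketWithin_apply.trans ((congr_arg _ key).trans (map_zero _))

variable {T} in
theorem Torus.bracket_eq_zero [CompleteSpace E] {A C : E} (hA : A ∈ T.lieAlgebra)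
    (hC : C ∈ T.lieAlgebra) : bracket G A C = 0 := by
  obtain ⟨u, rfl⟩ := T.mem_lieAlgebra_iff.1 hA
  obtain ⟨w, rfl⟩ := T.mem_lieAlgebra_iff.1 hC
  exact T.bracket_dexp u w

end Commute

/-! ### Curves tangent to 𝔱 and to a linear subspace -/

section Curves

variable {E : Type*} [NormedAddCommGroup E] [NormedSpace ℝ E]
variable {G : Type*} [TopologicalSpace G] [ChartedSpace E G] [Group G] {r : ℕ}
variable [LieGroup 𝓘(ℝ, E) ∞ G] (T : Torus E G r)

/-- The left logarithmic derivative of a smooth curve in a Lie group is continuous. -/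
theorem continuous_leftTriv_differential {γ : ℝ → G} (hγ : ContMDiff 𝓘(ℝ, ℝ) 𝓘(ℝ, E) ∞ γ) :
    Continuous fun s => leftTriv (γ s) (differential 𝓘(ℝ, ℝ) 𝓘(ℝ, E) γ s 1) := by
  have hm : IsManifold 𝓘(ℝ, E) 1 G := isManifold_one
  have hm3 : IsManifold 𝓘(ℝ, E) ∞ G := inferInstance
  let φ := extChartAt 𝓘(ℝ, E) (1 : G)
  -- The logarithmic derivative at s is the u-derivative of γ(s)⁻¹γ(s+u) at u = 0. All these curves
  -- pass through 1 at u = 0, so the single chart at 1 serves every s, and joint smoothness in (s,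
  -- u) gives continuity.
  let f : ℝ × ℝ → G := fun p => (γ p.1)⁻¹ * γ (p.1 + p.2)
  have hf0 : ∀ s, f (s, 0) = 1 := fun s => by simp [f]
  have hf : ContMDiff 𝓘(ℝ, ℝ × ℝ) 𝓘(ℝ, E) ∞ f := by
    have h1 : ContMDiff 𝓘(ℝ, ℝ × ℝ) 𝓘(ℝ, E) ∞ fun p : ℝ × ℝ => (γ p.1)⁻¹ :=
      (hγ.comp (contDiff_fst.contMDiff)).inv
    have h2 : ContMDiff 𝓘(ℝ, ℝ × ℝ) 𝓘(ℝ, E) ∞ fun p : ℝ × ℝ => γ (p.1 + p.2) :=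
      hγ.comp (contDiff_fst.add contDiff_snd).contMDiff
    exact h1.mul h2
  let g : ℝ × ℝ → E := fun p => φ (f p)
  have hg : ∀ s, ContDiffAt ℝ ∞ g (s, 0) := by
    intro s
    have h1 : ContMDiffAt 𝓘(ℝ, E) 𝓘(ℝ, E) ∞ φ (f (s, 0)) := by
      rw [hf0]
      exact contMDiffAt_extChartAt
    exact (ContMDiffAt.comp (s, (0 : ℝ)) h1 hf.contMDiffAt).contDiffAt
  have hsymm : HasDifferential 𝓘(ℝ, E) 𝓘(ℝ, E) φ.symm (φ 1)
      (differential 𝓘(ℝ, E) 𝓘(ℝ, E) φ.symm (φ 1)) := by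
    refine MDifferentiableAt.hasDifferential ?_
    have h := mdifferentiableWithinAt_extChartAt_symm (I := 𝓘(ℝ, E))
      (mem_extChartAt_target (I := 𝓘(ℝ, E)) (1 : G))
    rw [ModelWithCorners.range_eq_univ, mdifferentiableWithinAt_univ] at h
    exact h
  have key : ∀ s, leftTriv (γ s) (differential 𝓘(ℝ, ℝ) 𝓘(ℝ, E) γ s 1) =
      differential 𝓘(ℝ, E) 𝓘(ℝ, E) φ.symm (φ 1) (fderiv ℝ g (s, 0) (0, 1)) := by
    intro s
    have hadd : HasFDerivAt (fun u : ℝ => s + u) (ContinuousLinearMap.id ℝ ℝ) 0 :=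
      (hasFDerivAt_id 0).const_add s
    have hγs : HasDifferential 𝓘(ℝ, ℝ) 𝓘(ℝ, E) γ s (differential 𝓘(ℝ, ℝ) 𝓘(ℝ, E) γ s) :=
      MDifferentiableAt.hasDifferential (hγ.mdifferentiableAt (by simp))
    have h1 := (hasDifferential_inv_mul_self (E := E) (γ s)).comp
      (hγs.comp (hasDifferential_iff_hasFDerivAt.2 hadd) (add_zero s))
      (by rw [add_zero])
    have hmk : HasFDerivAt (fun u : ℝ => ((s, u) : ℝ × ℝ)) (ContinuousLinearMap.inr ℝ ℝ ℝ) 0 :=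
      hasFDerivAt_prodMk_right s 0
    have hgs : HasFDerivAt g (fderiv ℝ g (s, 0)) (s, 0) :=
      ((hg s).differentiableAt (by simp)).hasFDerivAt
    have h2 := hsymm.comp (hasDifferential_iff_hasFDerivAt.2 (hgs.comp 0 hmk))
      (by simp only [Function.comp_apply, g, hf0])
    have h3 := h2.congr (g := fun u => (γ s)⁻¹ * γ (s + u)) (by
      have hcont : Continuous fun u : ℝ => f (s, u) := hf.continuous.comp (by fun_prop)
      have hev : ∀ᶠ u in nhds (0 : ℝ), f (s, u) ∈ φ.source := by
        refine hcont.continuousAt.preimage_mem_nhds ?_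
        rw [hf0]
        exact extChartAt_source_mem_nhds _
      filter_upwards [hev] with u hu
      exact (φ.left_inv hu).symm)
    have h4 := DFunLike.congr_fun (h1.unique h3) 1
    simpa using h4
  simp only [key]
  refine (ContinuousLinearMap.continuous _).comp ?_
  refine Continuous.clm_apply ?_ continuous_const
  refine continuous_iff_continuousAt.2 fun s => ?_
  have h1 : ContinuousAt (fderiv ℝ g) (s, 0) :=
    ((hg s).fderiv_right (m := 0) (by simp)).continuousAt
  exact ContinuousAt.comp (f := fun s : ℝ => ((s, 0) : ℝ × ℝ)) h1 (by fun_prop)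

/-- A smooth curve in `G` tangent to the left-invariant distribution `𝔱` stays in a coset of `T`. -/
theorem Torus.exists_eq_mul_exp [FiniteDimensional ℝ E] {γ : ℝ → G}
    (hγ : ContMDiff 𝓘(ℝ, ℝ) 𝓘(ℝ, E) ∞ γ)
    (ht : ∀ s, leftTriv (γ s) (differential 𝓘(ℝ, ℝ) 𝓘(ℝ, E) γ s 1) ∈ T.lieAlgebra) (s : ℝ) :
    ∃ v, γ s = γ 0 * T.exp v := by
  have hm : IsManifold 𝓘(ℝ, E) 1 G := isManifold_one
  obtain ⟨P, hP⟩ := T.dexp.toLinearMap.exists_leftInverse_of_injective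
    (LinearMap.ker_eq_bot.2 T.dexp_injective)
  have hP' : ∀ v, P (T.dexp v) = v := fun v => LinearMap.congr_fun hP v
  let a : ℝ → Fin r → ℝ := fun s =>
    P (leftTriv (γ s) (differential 𝓘(ℝ, ℝ) 𝓘(ℝ, E) γ s 1))
  have ha : Continuous a :=
    P.continuous_of_finiteDimensional.comp (continuous_leftTriv_differential hγ)
  have hDa : ∀ s, differential 𝓘(ℝ, ℝ) 𝓘(ℝ, E) γ s 1 = leftTransl (γ s) (T.dexp (a s)) := by
    intro s
    obtain ⟨v, hv⟩ := T.mem_lieAlgebra_iff.1 (ht s)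
    simp only [a]
    rw [← hv, hP', hv, leftTransl_leftTriv]
  -- The candidate exponent is the primitive of the coordinates `a` of the logarithmic derivative.
  let A : ℝ → Fin r → ℝ := fun s => ∫ u in (0 : ℝ)..s, a u
  have hA : ∀ s, HasDerivAt A (a s) s := fun s =>
    (ha.integral_hasStrictDerivAt 0 s).hasDerivAt
  have hmul : ∀ p : G × G, HasDifferential (𝓘(ℝ, E).prod 𝓘(ℝ, E)) 𝓘(ℝ, E)
      (fun p : G × G => p.1 * p.2) p
      (differential (𝓘(ℝ, E).prod 𝓘(ℝ, E)) 𝓘(ℝ, E) (fun p : G × G => p.1 * p.2) p) := fun p =>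
    MDifferentiableAt.hasDifferential ((contMDiff_mul 𝓘(ℝ, E) ∞).mdifferentiableAt (by simp))
  have hexp : ∀ v, HasDifferential 𝓘(ℝ, Fin r → ℝ) 𝓘(ℝ, E) T.exp v
      ((leftTransl (T.exp v)).comp T.dexp) := by
    intro v
    simpa only [one_mul] using T.hasDifferential_mul_exp 1 v
  have hzero : ∀ s, HasDifferential 𝓘(ℝ, ℝ) 𝓘(ℝ, E) (fun s => γ s * T.exp (-A s)) s 0 := by
    intro s
    have hγs : HasDifferential 𝓘(ℝ, ℝ) 𝓘(ℝ, E) γ s (differential 𝓘(ℝ, ℝ) 𝓘(ℝ, E) γ s) :=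
      MDifferentiableAt.hasDifferential (hγ.mdifferentiableAt (by simp))
    have h1 := (hexp (-A s)).comp (hasDifferential_iff_hasFDerivAt.2 (hA s).neg.hasFDerivAt) rfl
    have h2 := (hmul (γ s, T.exp (-A s))).comp (hγs.prodMk h1) rfl
    -- The derivative of the product is found by comparison: t ↦ γ(s)exp(ta) · exp(-A(s) - ta) is
    -- constant, and its two factors have at t = 0 the same values and velocities as γ and exp(-A)
    -- at s. So the differential of multiplication kills this pair of velocities.
    have l1 : HasFDerivAt (fun t : ℝ => t • a s) (ContinuousLinearMap.toSpanSingleton ℝ (a s)) 0 :=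
      (ContinuousLinearMap.toSpanSingleton ℝ (a s)).hasFDerivAt
    have k1 := (T.hasDifferential_mul_exp (γ s) 0).comp
      (hasDifferential_iff_hasFDerivAt.2 l1) (zero_smul ℝ (a s))
    have k2 := (hexp (-A s)).comp
      (hasDifferential_iff_hasFDerivAt.2 (l1.const_sub (-A s))) (by simp)
    have k3 := (hmul (γ s, T.exp (-A s))).comp (k1.prodMk k2) (by simp [T.exp_zero])
    have hc : (fun t : ℝ => γ s * T.exp (t • a s) * T.exp (-A s - t • a s)) =
        fun _ => γ s * T.exp (-A s) := by
      funext t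
      rw [mul_assoc, ← T.exp_add, add_sub_cancel]
    simp only [hc] at k3
    have k4 := k3.unique (hasDifferential_const _ _)
    have e : (differential 𝓘(ℝ, ℝ) 𝓘(ℝ, E) γ s).prod (((leftTransl (T.exp (-A s))).comp
          T.dexp).comp (ContinuousLinearMap.toSpanSingleton ℝ (-a s))) =
        ((((leftTransl (γ s * T.exp 0)).comp T.dexp).comp
          (ContinuousLinearMap.toSpanSingleton ℝ (a s))).prod
          (((leftTransl (T.exp (-A s))).comp T.dexp).comp
            (-ContinuousLinearMap.toSpanSingleton ℝ (a s)))) := by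
      refine ContinuousLinearMap.ext_ring (Prod.ext ?_ ?_)
      · simp [hDa, T.exp_zero]
      · simp
    rw [e, k4] at h2
    exact h2
  refine ⟨A s, ?_⟩
  have h := eq_of_hasDifferential_zero hzero s 0
  simp only [A, intervalIntegral.integral_same, neg_zero, T.exp_zero, mul_one] at h
  rw [← h, mul_assoc, ← T.exp_add]
  simp [A, T.exp_zero]

/-- A curve in a vector space with derivative in a subspace stays in a translate of it. -/
theorem sub_mem_of_hasFDerivAt [FiniteDimensional ℝ E] (S : Submodule ℝ E) {γ : ℝ → E}
    {γ' : ℝ → ℝ →L[ℝ] E} (hγ : ∀ s, HasFDerivAt γ (γ' s) s) (hS : ∀ s, γ' s 1 ∈ S) (s t : ℝ) :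
    γ s - γ t ∈ S := by
  obtain ⟨p, hp⟩ := S.exists_isCompl
  -- The projection `q` has kernel `S`, so γ becomes constant after applying it.
  let q : E →L[ℝ] p := LinearMap.toContinuousLinearMap (p.projectionOnto S hp.symm)
  have hd : ∀ s, HasFDerivAt (fun s => q (γ s)) (0 : ℝ →L[ℝ] p) s := by
    intro s
    have h1 := q.hasFDerivAt.comp s (hγ s)
    have e : q.comp (γ' s) = 0 := by
      refine ContinuousLinearMap.ext_ring ?_
      exact (p.projectionOnto_apply_eq_zero_iff hp.symm).2 (hS s)
    rw [e] at h1
    exact h1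
  have h := is_const_of_fderiv_eq_zero (𝕜 := ℝ) (fun s => (hd s).differentiableAt)
    (fun s => (hd s).fderiv) s t
  refine (p.projectionOnto_apply_eq_zero_iff hp.symm).1 ?_
  change q (γ s - γ t) = 0
  rw [map_sub, sub_eq_zero]
  exact h

end Curves

/-! ### Linear algebra of the polarization -/

section Algebra

variable {E : Type*} [NormedAddCommGroup E] [NormedSpace ℝ E]

theorem tmul_eq_re_add_im (z : ℂ) (a : E) :
    z ⊗ₜ[ℝ] a = (1 : ℂ) ⊗ₜ[ℝ] (z.re • a) + Complex.I ⊗ₜ[ℝ] (z.im • a) := by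
  rw [← TensorProduct.smul_tmul, ← TensorProduct.smul_tmul, ← TensorProduct.add_tmul]
  congr 1
  apply Complex.ext <;> simp

theorem smul_one_tmul_add_I_tmul (z : ℂ) (a b : E) :
    z • ((1 : ℂ) ⊗ₜ[ℝ] a + Complex.I ⊗ₜ[ℝ] b) =
      (1 : ℂ) ⊗ₜ[ℝ] (z.re • a - z.im • b) + Complex.I ⊗ₜ[ℝ] (z.im • a + z.re • b) := by
  rw [smul_add, TensorProduct.smul_tmul', TensorProduct.smul_tmul', tmul_eq_re_add_im (z • 1),
    tmul_eq_re_add_im (z • Complex.I)]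
  simp only [smul_eq_mul, mul_one, Complex.mul_re, Complex.mul_im, Complex.I_re, Complex.I_im,
    mul_zero, zero_sub, add_zero, TensorProduct.tmul_add, TensorProduct.tmul_sub,
    neg_smul, TensorProduct.tmul_neg]
  abel

theorem mem_baseChange_iff {S : Submodule ℝ E} {A : ℂ ⊗[ℝ] E} :
    A ∈ S.baseChange ℂ ↔
      ∃ a ∈ S, ∃ b ∈ S, A = (1 : ℂ) ⊗ₜ[ℝ] a + Complex.I ⊗ₜ[ℝ] b := by
  constructor
  · intro hA
    rw [Submodule.baseChange_eq_span] at hA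
    induction hA using Submodule.span_induction with
    | mem A hA =>
      obtain ⟨a, ha, rfl⟩ := hA
      exact ⟨a, ha, 0, S.zero_mem, by simp⟩
    | zero => exact ⟨0, S.zero_mem, 0, S.zero_mem, by simp⟩
    | add A A' _ _ h h' =>
      obtain ⟨a, ha, b, hb, rfl⟩ := h
      obtain ⟨a', ha', b', hb', rfl⟩ := h'
      refine ⟨a + a', S.add_mem ha ha', b + b', S.add_mem hb hb', ?_⟩
      rw [TensorProduct.tmul_add, TensorProduct.tmul_add]
      abel
    | smul z A _ h =>
      obtain ⟨a, ha, b, hb, rfl⟩ := h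
      exact ⟨_, S.sub_mem (S.smul_mem _ ha) (S.smul_mem _ hb), _,
        S.add_mem (S.smul_mem _ ha) (S.smul_mem _ hb), smul_one_tmul_add_I_tmul z a b⟩
  · rintro ⟨a, ha, b, hb, rfl⟩
    exact add_mem (Submodule.tmul_mem_baseChange_of_mem _ ha)
      (Submodule.tmul_mem_baseChange_of_mem _ hb)

/-- The real part `1 ⊗ a + i ⊗ b ↦ a` of a complexified vector. -/
def rePart : ℂ ⊗[ℝ] E →ₗ[ℝ] E :=
  (TensorProduct.lid ℝ E).toLinearMap ∘ₗ Complex.reLm.rTensor E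

theorem rePart_apply (a b : E) : rePart ((1 : ℂ) ⊗ₜ[ℝ] a + Complex.I ⊗ₜ[ℝ] b) = a := by
  simp [rePart]

theorem mem_of_mem_baseChange {S : Submodule ℝ E} {a b : E}
    (h : (1 : ℂ) ⊗ₜ[ℝ] a + Complex.I ⊗ₜ[ℝ] b ∈ S.baseChange ℂ) : a ∈ S := by
  obtain ⟨a', ha', b', _, h'⟩ := mem_baseChange_iff.1 h
  have := congr_arg rePart h'
  rw [rePart_apply, rePart_apply] at this
  rwa [this]

/-- The real parts of a complex vector. -/
def reVec (r : ℕ) : (Fin r → ℂ) →L[ℝ] (Fin r → ℝ) :=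
  ContinuousLinearMap.pi fun k => Complex.reCLM.comp (ContinuousLinearMap.proj k)

/-- The imaginary parts of a complex vector. -/
def imVec (r : ℕ) : (Fin r → ℂ) →L[ℝ] (Fin r → ℝ) :=
  ContinuousLinearMap.pi fun k => Complex.imCLM.comp (ContinuousLinearMap.proj k)

theorem reVec_apply {r : ℕ} (ξ : Fin r → ℂ) (k : Fin r) : reVec r ξ k = (ξ k).re := rfl

theorem imVec_apply {r : ℕ} (ξ : Fin r → ℂ) (k : Fin r) : imVec r ξ k = (ξ k).im := rfl

theorem reVec_I_smul {r : ℕ} (ξ : Fin r → ℂ) : reVec r (Complex.I • ξ) = -imVec r ξ := by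
  ext k
  simp [reVec_apply, imVec_apply]

theorem imVec_I_smul {r : ℕ} (ξ : Fin r → ℂ) : imVec r (Complex.I • ξ) = reVec r ξ := by
  ext k
  simp [reVec_apply, imVec_apply]

theorem exists_reVec_imVec {r : ℕ} (a b : Fin r → ℝ) : ∃ ξ, reVec r ξ = a ∧ imVec r ξ = b :=
  ⟨fun k => ⟨a k, b k⟩, rfl, rfl⟩

/-- The map `ξ ↦ (D (Im ξ + (σ₁ / σ₂) Re ξ), -σ₂⁻¹ K (Re ξ))`: the tangent map of the leaf, in
logarithmic holomorphic coordinates. -/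
def leafTangent {r : ℕ} (σ : ℂ) (D K : (Fin r → ℝ) →L[ℝ] E) : (Fin r → ℂ) →L[ℝ] E × E :=
  (D.comp (imVec r + (σ.re / σ.im) • reVec r)).prod (-(σ.im⁻¹ • K.comp (reVec r)))

theorem leafTangent_apply {r : ℕ} (σ : ℂ) (D K : (Fin r → ℝ) →L[ℝ] E) (ξ : Fin r → ℂ) :
    leafTangent σ D K ξ = (D (imVec r ξ) + (σ.re / σ.im) • D (reVec r ξ),
      -(σ.im⁻¹ • K (reVec r ξ))) := by
  simp [leafTangent]

theorem leafTangent_I_smul {r : ℕ} (σ : ℂ) (D K : (Fin r → ℝ) →L[ℝ] E) (ξ : Fin r → ℂ) :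
    leafTangent σ D K (Complex.I • ξ) = (D (reVec r ξ) - (σ.re / σ.im) • D (imVec r ξ),
      σ.im⁻¹ • K (imVec r ξ)) := by
  rw [leafTangent_apply, reVec_I_smul, imVec_I_smul]
  simp [sub_eq_add_neg]

theorem polMap_apply (σ : ℂ) (F : E →ₗ[ℝ] E) (A : ℂ ⊗[ℝ] E) :
    polMap σ F A = (-(starRingEnd ℂ σ) • F.baseChange ℂ A, A) := by
  simp only [polMap, LinearMap.prod_apply, Function.prod_apply, LinearMap.smul_apply,
    LinearMap.id_apply]

/-- This identity dictates the coefficients of `leafTangent`: for A = -σ₂⁻¹(K Re ξ + i K Im ξ) one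
gets -σ̄FA = (σ₁/σ₂ - i)(D Re ξ + i D Im ξ), whose real part is D(Im ξ + (σ₁/σ₂) Re ξ). -/
theorem cplx_leafTangent {r : ℕ} {σ : ℂ} (hσ : σ.im ≠ 0) {D K : (Fin r → ℝ) →L[ℝ] E}
    {F : E →ₗ[ℝ] E} (hFK : ∀ v, F (K v) = D v) (ξ : Fin r → ℂ) :
    cplx (leafTangent σ D K ξ) (-leafTangent σ D K (Complex.I • ξ)) =
      polMap σ F ((1 : ℂ) ⊗ₜ[ℝ] (-(σ.im⁻¹ • K (reVec r ξ))) +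
        Complex.I ⊗ₜ[ℝ] (-(σ.im⁻¹ • K (imVec r ξ)))) := by
  rw [leafTangent_apply, leafTangent_I_smul]
  refine Prod.ext ?_ rfl
  rw [polMap_apply, map_add, LinearMap.baseChange_tmul, LinearMap.baseChange_tmul, map_neg, map_neg,
    map_smul, map_smul, hFK, hFK, smul_one_tmul_add_I_tmul]
  simp only [cplx, Prod.fst_neg]
  congr 2
  · simp only [Complex.neg_re, Complex.neg_im, Complex.conj_re, Complex.conj_im]
    match_scalars <;> field_simp
  · simp only [Complex.neg_re, Complex.neg_im, Complex.conj_re, Complex.conj_im]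
    match_scalars <;> field_simp

variable {G : Type*} [TopologicalSpace G] [ChartedSpace E G] [Group G] {r : ℕ}
variable {B : InvariantInner (E := E) G} {T : Torus E G r} {F : E →ₗ[ℝ] E}

theorem IsTorusQuadratic.eq_zero (hF : IsTorusQuadratic B T F) {A : E} (hA : A ∈ T.lieAlgebra)
    (h : F A = 0) : A = 0 := by
  by_contra hne
  have := hF.pos A hA hne
  rw [h, map_zero] at this
  exact lt_irrefl _ this

/-- A linear parametrization `K` of `𝔱` with `F ∘ K` the differential of the exponential map. -/
structure TorusSection (T : Torus E G r) (F : E →ₗ[ℝ] E) where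
  map : (Fin r → ℝ) →L[ℝ] E
  mem : ∀ v, map v ∈ T.lieAlgebra
  apply_map : ∀ v, F (map v) = T.dexp v
  surj : ∀ A ∈ T.lieAlgebra, ∃ v, map v = A

/-- Definiteness makes `F` injective on 𝔱, hence bijective there by finite dimension; `K` is the
inverse of this restriction composed with `dexp`. It is onto 𝔱: if `dexp v = F A` with A in 𝔱, then
`K v = A`. -/
theorem IsTorusQuadratic.nonempty_section [FiniteDimensional ℝ E] (hF : IsTorusQuadratic B T F) :
    Nonempty (TorusSection T F) := by
  let Ft : T.lieAlgebra →ₗ[ℝ] T.lieAlgebra :=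
    (F.comp T.lieAlgebra.subtype).codRestrict T.lieAlgebra fun A => hF.image_le A
  have hinj : Function.Injective Ft := by
    rw [injective_iff_map_eq_zero]
    intro A hA
    exact Subtype.ext (hF.eq_zero A.2 (congr_arg Subtype.val hA))
  let e := LinearEquiv.ofInjectiveEndo Ft hinj
  let D : (Fin r → ℝ) →ₗ[ℝ] T.lieAlgebra := T.dexp.toLinearMap.codRestrict _ T.dexp_mem
  let K : (Fin r → ℝ) →ₗ[ℝ] E := T.lieAlgebra.subtype ∘ₗ e.symm.toLinearMap ∘ₗ D
  have hFK : ∀ v, F (K v) = T.dexp v := fun v =>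
    congr_arg Subtype.val (e.apply_symm_apply (D v))
  have hKm : ∀ v, K v ∈ T.lieAlgebra := fun v => (e.symm (D v)).2
  refine ⟨⟨LinearMap.toContinuousLinearMap K, hKm, hFK, fun A hA => ?_⟩⟩
  obtain ⟨v, hv⟩ := T.mem_lieAlgebra_iff.1 (hF.image_le A)
  refine ⟨v, sub_eq_zero.1 (hF.eq_zero (T.lieAlgebra.sub_mem (hKm v) hA) ?_)⟩
  exact (map_sub F _ _).trans (sub_eq_zero.2 ((hFK v).trans hv))

variable {σ : ℂ}

theorem tPart_eq_range (hσ : σ.im ≠ 0) (hF : IsTorusQuadratic B T F)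
    (K : TorusSection T F) :
    (tPart T σ F : Set ((ℂ ⊗[ℝ] E) × (ℂ ⊗[ℝ] E))) =
      Set.range fun ξ => cplx (leafTangent σ T.dexp K.map ξ)
        (-leafTangent σ T.dexp K.map (Complex.I • ξ)) := by
  ext P
  constructor
  · rintro ⟨⟨A, rfl⟩, hA⟩
    obtain ⟨a, ha, b, hb, hab⟩ := mem_baseChange_iff.1 (show A ∈ _ from hA.2)
    obtain ⟨u, hu⟩ := K.surj a ha
    obtain ⟨v, hv⟩ := K.surj b hb
    -- With A = Ku + iKv, the formula A = -σ₂⁻¹K(ξ) forces ξ = -σ₂(u + iv).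
    obtain ⟨ξ, h1, h2⟩ := exists_reVec_imVec (-(σ.im • u)) (-(σ.im • v))
    refine ⟨ξ, ?_⟩
    simp only
    rw [cplx_leafTangent hσ K.apply_map, h1, h2, map_neg, map_neg, map_smul, map_smul, hu, hv, hab,
      smul_neg, smul_neg, neg_neg, neg_neg, inv_smul_smul₀ hσ, inv_smul_smul₀ hσ]
  · rintro ⟨ξ, rfl⟩
    simp only
    rw [cplx_leafTangent hσ K.apply_map]
    have hmem : (1 : ℂ) ⊗ₜ[ℝ] (-(σ.im⁻¹ • K.map (reVec r ξ))) +
        Complex.I ⊗ₜ[ℝ] (-(σ.im⁻¹ • K.map (imVec r ξ))) ∈ T.lieAlgebra.baseChange ℂ :=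
      mem_baseChange_iff.2 ⟨_, neg_mem (T.lieAlgebra.smul_mem _ (K.mem _)), _,
        neg_mem (T.lieAlgebra.smul_mem _ (K.mem _)), rfl⟩
    refine ⟨⟨_, rfl⟩, ?_, hmem⟩
    rw [polMap_apply]
    refine Submodule.smul_mem (T.lieAlgebra.baseChange ℂ) _ ?_
    rw [map_add, LinearMap.baseChange_tmul, LinearMap.baseChange_tmul]
    exact mem_baseChange_iff.2 ⟨_, hF.image_le _, _, hF.image_le _, rfl⟩

/-- As σ₂ ≠ 0, `leafTangent` maps onto 𝔱 ⊕ 𝔱: the vector (`dexp u`, `K v`) comes from Re ξ = -σ₂v,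
Im ξ = u + σ₁v. -/
theorem realDistribution_tPart [FiniteDimensional ℝ E] (hσ : σ.im ≠ 0)
    (hF : IsTorusQuadratic B T F) :
    realDistribution (tPart T σ F) = (T.lieAlgebra : Set E) ×ˢ (T.lieAlgebra : Set E) := by
  obtain ⟨K⟩ := hF.nonempty_section
  ext X
  constructor
  · rintro ⟨Y, hY⟩
    exact ⟨mem_of_mem_baseChange hY.2.1, mem_of_mem_baseChange hY.2.2⟩
  · rintro ⟨h1, h2⟩
    obtain ⟨u, hu⟩ := T.mem_lieAlgebra_iff.1 h1
    obtain ⟨v, hv⟩ := K.surj _ h2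
    obtain ⟨ξ, e1, e2⟩ := exists_reVec_imVec (-(σ.im • v)) (u + σ.re • v)
    have hX : leafTangent σ T.dexp K.map ξ = X := by
      rw [leafTangent_apply, e1, e2]
      refine Prod.ext ?_ ?_
      · simp only [map_add, map_smul, map_neg, hu]
        match_scalars <;> field_simp
        simp
      · simp only [map_smul, map_neg, hv]
        rw [smul_neg, neg_neg, inv_smul_smul₀ hσ]
    refine ⟨-leafTangent σ T.dexp K.map (Complex.I • ξ), ?_⟩
    rw [← hX]
    exact (tPart_eq_range hσ hF K).ge ⟨ξ, rfl⟩

end Algebra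

/-! ### The leaves of the real distribution -/

section LeafThrough

variable {E : Type*} [NormedAddCommGroup E] [NormedSpace ℝ E] [FiniteDimensional ℝ E]
variable {G : Type*} [TopologicalSpace G] [ChartedSpace E G] [Group G] {r : ℕ}
variable [LieGroup 𝓘(ℝ, E) ∞ G] (T : Torus E G r)

theorem Torus.leafThrough_eq (x : G) (y : E) :
    leafThrough ((T.lieAlgebra : Set E) ×ˢ (T.lieAlgebra : Set E)) (x, y) = T.leaf x y := by
  ext q
  constructor
  · rintro ⟨γ, hγ, h0, h1, ht⟩
    have hd : ∀ s, HasDifferential 𝓘(ℝ, ℝ) (𝓘(ℝ, E).prod 𝓘(ℝ, E)) γ s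
        (differential 𝓘(ℝ, ℝ) (𝓘(ℝ, E).prod 𝓘(ℝ, E)) γ s) := fun s =>
      MDifferentiableAt.hasDifferential (hγ.mdifferentiableAt (by simp))
    have hmem1 : ∀ s, leftTriv (γ s).1 (differential 𝓘(ℝ, ℝ) (𝓘(ℝ, E).prod 𝓘(ℝ, E)) γ s 1).1 ∈
        T.lieAlgebra := fun s => (ht s).1
    have hmem2 : ∀ s, (differential 𝓘(ℝ, ℝ) (𝓘(ℝ, E).prod 𝓘(ℝ, E)) γ s 1).2 ∈
        T.lieAlgebra := fun s => (ht s).2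
    obtain ⟨v, hv⟩ := T.exists_eq_mul_exp (γ := fun s => (γ s).1) hγ.fst (fun s => by
      rw [(hd s).fst.differential_eq]
      exact hmem1 s) 1
    have hs := sub_mem_of_hasFDerivAt T.lieAlgebra (γ := fun s => (γ s).2)
      (fun s => hasDifferential_iff_hasFDerivAt.1 (hd s).snd) hmem2 1 0
    simp only [h0, h1] at hv hs
    exact ⟨T.mem_fiber_iff.2 ⟨v, hv⟩, ⟨_, hs, by simp⟩⟩
  · rintro ⟨h1, ⟨a, ha, h2⟩⟩
    obtain ⟨v, hv⟩ := T.mem_fiber_iff.1 h1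
    have hlin : ContDiff ℝ ∞ fun s : ℝ => s • v := contDiff_id.smul contDiff_const
    have hlin' : ContDiff ℝ ∞ fun s : ℝ => y + s • a :=
      contDiff_const.add (contDiff_id.smul contDiff_const)
    have hs : ContMDiff 𝓘(ℝ, ℝ) 𝓘(ℝ, E) ∞ fun s : ℝ => x * T.exp (s • v) :=
      contMDiff_const.mul (T.contMDiff_exp.comp hlin.contMDiff)
    -- Any point of the leaf is reached by a one-parameter curve in `T` paired with a straight line;
    -- its trivialized velocity is constantly (`dexp v`, `a`).
    refine ⟨fun s => (x * T.exp (s • v), y + s • a), hs.prodMk hlin'.contMDiff, ?_, ?_, ?_⟩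
    · simp [T.exp_zero]
    · refine Prod.ext ?_ ?_
      · simp [hv]
      · simpa using h2
    · intro s
      have k1 : HasFDerivAt (fun s : ℝ => s • v) (ContinuousLinearMap.toSpanSingleton ℝ v) s :=
        (ContinuousLinearMap.toSpanSingleton ℝ v).hasFDerivAt
      have k2 : HasFDerivAt (fun s : ℝ => y + s • a)
          (ContinuousLinearMap.toSpanSingleton ℝ a) s :=
        (ContinuousLinearMap.toSpanSingleton ℝ a).hasFDerivAt.const_add y
      have k3 := ((T.hasDifferential_mul_exp x (s • v)).comp
        (hasDifferential_iff_hasFDerivAt.2 k1) rfl).prodMk (hasDifferential_iff_hasFDerivAt.2 k2)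
      have k4 := DFunLike.congr_fun k3.differential_eq 1
      have k5 : triv (x * T.exp (s • v), y + s • a)
          (differential 𝓘(ℝ, ℝ) (𝓘(ℝ, E).prod 𝓘(ℝ, E))
            (fun s : ℝ => (x * T.exp (s • v), y + s • a)) s 1) = (T.dexp v, a) := by
        rw [k4]
        simp [triv, leftTriv_leftTransl]
      exact k5 ▸ ⟨T.dexp_mem v, ha⟩

end LeafThrough

/-! ### Twisted polar coordinates on (ℂ^*)^r -/

section Polar

/-- The polar decomposition `z ↦ (exp ((-1 + ic) log |z|) z, log |z|)` of the complex torus, twisted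
by a real number `c`. -/
def polarHomeomorph (r : ℕ) (c : ℝ) : complexTorus r ≃ₜ (Fin r → Circle) × (Fin r → ℝ) where
  toFun z :=
    (fun k => ⟨Complex.exp ((-1 + Complex.I * c) * Real.log ‖z.1 k‖) * z.1 k, by
      have hz : 0 < ‖z.1 k‖ := norm_pos_iff.2 (z.2 k)
      refine mem_sphere_zero_iff_norm.2 ?_
      rw [norm_mul, Complex.norm_exp]
      have : ((-1 + Complex.I * c) * Real.log ‖z.1 k‖ : ℂ).re = -Real.log ‖z.1 k‖ := by simp
      rw [this, Real.exp_neg, Real.exp_log hz, inv_mul_cancel₀ hz.ne']⟩,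
     fun k => Real.log ‖z.1 k‖)
  invFun p :=
    ⟨fun k => Complex.exp (-((-1 + Complex.I * c) * p.2 k)) * p.1 k, fun k =>
      mul_ne_zero (Complex.exp_ne_zero _) (Circle.coe_ne_zero _)⟩
  left_inv z := by
    refine Subtype.ext (funext fun k => ?_)
    simp only
    rw [← mul_assoc, ← Complex.exp_add, neg_add_cancel, Complex.exp_zero, one_mul]
  right_inv p := by
    have h : ∀ k, Real.log ‖Complex.exp (-((-1 + Complex.I * c) * p.2 k)) * p.1 k‖ = p.2 k := by
      intro k
      rw [norm_mul, Circle.norm_coe, mul_one, Complex.norm_exp, Real.log_exp]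
      simp
    refine Prod.ext (funext fun k => Circle.ext ?_) (funext fun k => h k)
    simp only [h]
    rw [← mul_assoc, ← Complex.exp_add, add_neg_cancel, Complex.exp_zero, one_mul]
  continuous_toFun := by
    have hz : ∀ k, Continuous fun z : complexTorus r => z.1 k := fun k =>
      (continuous_apply k).comp continuous_subtype_val
    have hl : ∀ k, Continuous fun z : complexTorus r => Real.log ‖z.1 k‖ := fun k =>
      (hz k).norm.log fun z => norm_ne_zero_iff.2 (z.2 k)
    refine Continuous.prodMk (continuous_pi fun k => Continuous.subtype_mk ?_ _)
      (continuous_pi hl)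
    exact ((continuous_const.mul (Complex.continuous_ofReal.comp (hl k))).cexp).mul (hz k)
  continuous_invFun := by
    refine Continuous.subtype_mk (continuous_pi fun k => ?_) _
    have h1 : Continuous fun p : (Fin r → Circle) × (Fin r → ℝ) => (p.1 k : ℂ) :=
      continuous_subtype_val.comp ((continuous_apply k).comp continuous_fst)
    have h2 : Continuous fun p : (Fin r → Circle) × (Fin r → ℝ) => (p.2 k : ℂ) :=
      Complex.continuous_ofReal.comp ((continuous_apply k).comp continuous_snd)
    exact ((continuous_const.mul h2).neg.cexp).mul h1

/-- The twist turns the angle Im ξ into Im ξ + c Re ξ, as the leaf requires with c = σ₁/σ₂.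
`polarHomeomorph` itself involves no branch of the logarithm, so it is global. -/
theorem polarHomeomorph_exp {r : ℕ} (c : ℝ) (z : complexTorus r) (ξ : Fin r → ℂ)
    (h : ∀ k, Complex.exp (ξ k) = z.1 k) :
    polarHomeomorph r c z =
      (fun k => Circle.exp ((imVec r ξ + c • reVec r ξ) k), reVec r ξ) := by
  have hl : ∀ k, Real.log ‖z.1 k‖ = (ξ k).re := fun k => by
    rw [← h, Complex.norm_exp, Real.log_exp]
  refine Prod.ext (funext fun k => Circle.ext ?_) (funext fun k => hl k)
  change Complex.exp ((-1 + Complex.I * c) * Real.log ‖z.1 k‖) * z.1 k = _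
  rw [hl, ← h, ← Complex.exp_add, Circle.coe_exp]
  congr 1
  apply Complex.ext <;> simp [reVec_apply, imVec_apply]
  ring

theorem polarHomeomorph_smul {r : ℕ} (c : ℝ) (t : Fin r → Circle) (z w : complexTorus r)
    (h : ∀ k, w.1 k = t k * z.1 k) :
    polarHomeomorph r c w = (t * (polarHomeomorph r c z).1, (polarHomeomorph r c z).2) := by
  have hl : ∀ k, ‖w.1 k‖ = ‖z.1 k‖ := fun k => by
    rw [h, norm_mul, Circle.norm_coe, one_mul]
  refine Prod.ext (funext fun k => Circle.ext ?_) (funext fun k => ?_)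
  · change Complex.exp ((-1 + Complex.I * c) * Real.log ‖w.1 k‖) * w.1 k =
      t k * (Complex.exp ((-1 + Complex.I * c) * Real.log ‖z.1 k‖) * z.1 k)
    rw [hl, h]
    ring
  · change Real.log ‖w.1 k‖ = Real.log ‖z.1 k‖
    rw [hl]

/-- The covering ℝ^r → (S¹)^r is a continuous open surjection, hence a quotient map. This recovers
continuity of `T.hom` from the smoothness assumed on ℝ^r. -/
theorem continuous_of_continuous_comp_exp {r : ℕ} {X : Type*} [TopologicalSpace X]
    {f : (Fin r → Circle) → X} (h : Continuous fun s : Fin r → ℝ => f fun k => Circle.exp (s k)) :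
    Continuous f := by
  have ho : IsOpenMap fun s : Fin r → ℝ => fun k => Circle.exp (s k) := by
    exact IsOpenMap.piMap (f := fun _ : Fin r => Circle.exp)
      (fun _ => isLocalHomeomorph_circleExp.isOpenMap)
      (Filter.Eventually.of_forall fun _ => Circle.exp_surjective)
  have hs : Function.Surjective fun s : Fin r → ℝ => fun k => Circle.exp (s k) := fun t => by
    choose s hs using fun k => Circle.exp_surjective (t k)
    exact ⟨s, funext hs⟩
  have hc : Continuous fun s : Fin r → ℝ => fun k => Circle.exp (s k) :=
    continuous_pi fun k => Circle.exp.continuous.comp (continuous_apply k)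
  exact (ho.isQuotientMap hc hs).continuous_iff.2 h

end Polar

/-! ### The homeomorphism from (ℂ^*)^r to a leaf -/

section LeafHomeomorph

variable {E : Type*} [NormedAddCommGroup E] [NormedSpace ℝ E]
variable {G : Type*} [TopologicalSpace G] [ChartedSpace E G] [Group G] {r : ℕ}
variable {T : Torus E G r} {F : E →ₗ[ℝ] E}

variable (T) in
theorem Torus.continuous_hom : Continuous T.hom :=
  continuous_of_continuous_comp_exp (ContMDiff.continuous T.smooth)

theorem Torus.leaf_mem_iff {x : G} {y : E} {p : G × E} :
    p ∈ T.leaf x y ↔ (∃ t, p.1 = x * T.hom t) ∧ ∃ a ∈ T.lieAlgebra, p.2 = y + a := by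
  constructor
  · rintro ⟨h1, a, ha, h2⟩
    obtain ⟨s, hs⟩ := T.mem_fiber_iff.1 h1
    exact ⟨⟨_, hs⟩, a, ha, h2.symm⟩
  · rintro ⟨⟨t, ht⟩, a, ha, h2⟩
    obtain ⟨s, hs⟩ := T.exists_exp_eq t
    exact ⟨T.mem_fiber_iff.2 ⟨s, by rw [ht, hs]⟩, a, ha, h2.symm⟩

theorem TorusSection.map_injective [LieGroup 𝓘(ℝ, E) ∞ G] (K : TorusSection T F) :
    Function.Injective K.map := fun u v h =>
  T.dexp_injective (by rw [← K.apply_map, ← K.apply_map, h])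

/-- The parametrization `(t, ℓ) ↦ (x t, y - σ₂⁻¹ K ℓ)` of the leaf through `(x, y)`. -/
def TorusSection.param (K : TorusSection T F) (σ : ℂ) (x : G) (y : E)
    (p : (Fin r → Circle) × (Fin r → ℝ)) : G × E :=
  (x * T.hom p.1, y + -(σ.im⁻¹ • K.map p.2))

theorem TorusSection.range_param (K : TorusSection T F) {σ : ℂ} (hσ : σ.im ≠ 0) (x : G) (y : E) :
    Set.range (K.param σ x y) = T.leaf x y := by
  ext p
  rw [Torus.leaf_mem_iff]
  constructor
  · rintro ⟨p, rfl⟩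
    exact ⟨⟨p.1, rfl⟩, _, neg_mem (T.lieAlgebra.smul_mem _ (K.mem p.2)), rfl⟩
  · rintro ⟨⟨t, ht⟩, a, ha, h2⟩
    obtain ⟨v, rfl⟩ := K.surj a ha
    refine ⟨(t, -(σ.im • v)), Prod.ext ht.symm ?_⟩
    rw [h2]
    simp only [TorusSection.param, map_neg, map_smul, smul_neg, neg_neg, inv_smul_smul₀ hσ]

variable [LieGroup 𝓘(ℝ, E) ∞ G]

/-- The torus is compact and `G` is Hausdorff, so the injective map `T.hom` is a closed embedding;
the linear factor is one by injectivity in finite dimension. Hence the manifold topology is the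
subspace topology. -/
theorem TorusSection.isEmbedding_param [T2Space G] (K : TorusSection T F) {σ : ℂ}
    (hσ : σ.im ≠ 0) (x : G) (y : E) : Topology.IsEmbedding (K.param σ x y) := by
  have : IsTopologicalGroup G := topologicalGroup_of_lieGroup 𝓘(ℝ, E) ∞
  have h1 : Topology.IsEmbedding fun t : Fin r → Circle => x * T.hom t :=
    (Homeomorph.mulLeft x).isEmbedding.comp
      (T.continuous_hom.isClosedEmbedding T.injective).isEmbedding
  have h2 : Function.Injective (-(σ.im⁻¹ • K.map)) := by
    intro u v h
    have h' : -(σ.im⁻¹ • K.map u) = -(σ.im⁻¹ • K.map v) := h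
    exact K.map_injective (smul_right_injective E (inv_ne_zero hσ) (neg_injective h'))
  have h3 : Topology.IsEmbedding fun ℓ : Fin r → ℝ => y + (-(σ.im⁻¹ • K.map)) ℓ :=
    (Homeomorph.addLeft y).isEmbedding.comp
      (LinearMap.isClosedEmbedding_of_injective (f := (-(σ.im⁻¹ • K.map)).toLinearMap)
        (LinearMap.ker_eq_bot.2 h2)).isEmbedding
  exact h1.prodMap h3

/-- The homeomorphism of the complex torus onto a leaf. -/
def TorusSection.leafHomeomorph [T2Space G] (K : TorusSection T F) {σ : ℂ} (hσ : σ.im ≠ 0) (x : G)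
    (y : E) : complexTorus r ≃ₜ T.leaf x y :=
  (polarHomeomorph r (σ.re / σ.im)).trans
    ((K.isEmbedding_param hσ x y).toHomeomorph.trans (Homeomorph.setCongr (K.range_param hσ x y)))

theorem TorusSection.leafHomeomorph_apply [T2Space G] (K : TorusSection T F) {σ : ℂ}
    (hσ : σ.im ≠ 0) (x : G) (y : E) (z : complexTorus r) :
    (K.leafHomeomorph hσ x y z : G × E) = K.param σ x y (polarHomeomorph r (σ.re / σ.im) z) :=
  rfl

/-- The parametrization of the leaf in logarithmic coordinates. -/
def TorusSection.logParam (K : TorusSection T F) (σ : ℂ) (x : G) (y : E) (ξ : Fin r → ℂ) : G × E :=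
  (x * T.exp (imVec r ξ + (σ.re / σ.im) • reVec r ξ), y + -(σ.im⁻¹ • K.map (reVec r ξ)))

theorem TorusSection.leafHomeomorph_eq_logParam [T2Space G] (K : TorusSection T F) {σ : ℂ}
    (hσ : σ.im ≠ 0) (x : G) (y : E) (z : complexTorus r) (ξ : Fin r → ℂ)
    (h : ∀ k, Complex.exp (ξ k) = z.1 k) :
    (K.leafHomeomorph hσ x y z : G × E) = K.logParam σ x y ξ := by
  rw [K.leafHomeomorph_apply, polarHomeomorph_exp _ z ξ h]
  rfl

theorem TorusSection.leafHomeomorph_smul [T2Space G] (K : TorusSection T F) {σ : ℂ}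
    (hσ : σ.im ≠ 0) (x : G) (y : E) (t : Fin r → Circle) (z w : complexTorus r)
    (h : ∀ k, w.1 k = t k * z.1 k) :
    (K.leafHomeomorph hσ x y w : G × E) = ((K.leafHomeomorph hσ x y z : G × E).1 * T.hom t,
      (K.leafHomeomorph hσ x y z : G × E).2) := by
  rw [K.leafHomeomorph_apply, K.leafHomeomorph_apply, polarHomeomorph_smul _ t z w h]
  simp only [TorusSection.param]
  rw [mul_comm, map_mul, mul_assoc]

end LeafHomeomorph

/-! ### Derivatives of a single global chart -/

section SingleChart

variable {V : Type*} [NormedAddCommGroup V] [NormedSpace ℝ V]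
variable {L : Type*} [TopologicalSpace L] [Nonempty L] {φ : L → V}

/-- Read in itself, the only chart is the identity near the image of `p`. -/
theorem hasDifferential_chart (h : Topology.IsOpenEmbedding φ) (p : L) :
    letI := h.singletonChartedSpace
    HasDifferential 𝓘(ℝ, V) 𝓘(ℝ, V) φ p (ContinuousLinearMap.id ℝ V) := by
  let := h.singletonChartedSpace
  refine ⟨h.continuous.continuousAt, ?_⟩
  have h1 : HasFDerivWithinAt (fun z : V => z) (ContinuousLinearMap.id ℝ V)
      (Set.range 𝓘(ℝ, V)) (φ p) := hasFDerivWithinAt_id _ _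
  refine h1.congr_of_eventuallyEq ?_ ?_
  · have : Set.range φ ∈ nhds (φ p) := h.isOpen_range.mem_nhds ⟨p, rfl⟩
    filter_upwards [mem_nhdsWithin_of_mem_nhds this] with z hz
    exact h.toOpenPartialHomeomorph_right_inv φ hz
  · exact congr_arg φ (h.toOpenPartialHomeomorph_left_inv φ)

theorem hasDifferential_chart_symm (h : Topology.IsOpenEmbedding φ) {z : V}
    (hz : z ∈ Set.range φ) :
    letI := h.singletonChartedSpace
    HasDifferential 𝓘(ℝ, V) 𝓘(ℝ, V) (h.toOpenPartialHomeomorph φ).symm z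
      (ContinuousLinearMap.id ℝ V) := by
  let := h.singletonChartedSpace
  have hnhds : Set.range φ ∈ nhds z := h.isOpen_range.mem_nhds hz
  refine ⟨(h.toOpenPartialHomeomorph φ).continuousAt_symm (by simpa using hz), ?_⟩
  have h1 : HasFDerivWithinAt (fun z : V => z) (ContinuousLinearMap.id ℝ V)
      (Set.range 𝓘(ℝ, V)) z := hasFDerivWithinAt_id _ _
  refine h1.congr_of_eventuallyEq ?_ ?_
  · filter_upwards [mem_nhdsWithin_of_mem_nhds hnhds] with w hw
    exact h.toOpenPartialHomeomorph_right_inv φ hw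
  · exact h.toOpenPartialHomeomorph_right_inv φ hz

end SingleChart

/-! ### Pullbacks of 2-forms and the operator i∂∂̄ -/

section Calculus

variable {V : Type*} [NormedAddCommGroup V] [NormedSpace ℂ V]

/-- The pullback is quadratic in `f`, and it is exhibited as a composite of bounded linear and
bilinear operations ending in alternatization. -/
theorem contDiff_compContinuousLinearMap (Ω : V [⋀^Fin 2]→L[ℝ] ℝ) :
    ContDiff ℝ ∞ fun f : V →L[ℝ] V => Ω.compContinuousLinearMap f := by
  let J : (V →L[ℝ] ℝ) →L[ℝ] V [⋀^Fin 1]→L[ℝ] ℝ :=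
    (ContinuousAlternatingMap.ofSubsingletonLIE (𝕜 := ℝ) (E := V) (F := ℝ)
      (0 : Fin 1)).toContinuousLinearEquiv
  let J' : (V [⋀^Fin 1]→L[ℝ] ℝ) →L[ℝ] V →L[ℝ] ℝ :=
    (ContinuousAlternatingMap.ofSubsingletonLIE (𝕜 := ℝ) (E := V) (F := ℝ)
      (0 : Fin 1)).symm.toContinuousLinearEquiv
  let C : V →L[ℝ] V →L[ℝ] ℝ := J'.comp Ω.curryLeft
  have hC : ∀ a b, C a b = Ω ![a, b] := fun a b => by
    have h : C a b = Ω (Matrix.vecCons a fun _ => b) := rfl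
    rw [h]
    congr 1
    ext i
    fin_cases i <;> rfl
  -- Alternatizing Ω(f v₀, f v₁) gives Ω(f v₀, f v₁) - Ω(f v₁, f v₀), twice the pullback; hence the
  -- factor 1/2.
  have key : (fun f : V →L[ℝ] V => Ω.compContinuousLinearMap f) = fun f =>
      (1 / 2 : ℝ) • ContinuousAlternatingMap.alternatizeUncurryFinCLM ℝ V ℝ
        (J.comp (((ContinuousLinearMap.compL ℝ V V ℝ).flip f).comp (C.comp f))) := by
    funext f
    ext v
    have h1 : Ω.compContinuousLinearMap f v = Ω ![f (v 0), f (v 1)] := by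
      rw [ContinuousAlternatingMap.compContinuousLinearMap_apply]
      congr 1
      ext i
      fin_cases i <;> rfl
    have h2 : Ω ![f (v 1), f (v 0)] = -Ω ![f (v 0), f (v 1)] := by
      refine Eq.trans ?_ (Ω.toAlternatingMap.map_swap ![f (v 0), f (v 1)] (i := 0) (j := 1)
        (by simp))
      change _ = Ω _
      congr 1
      ext i
      fin_cases i <;> rfl
    have h3 : ∀ a b, J (((ContinuousLinearMap.compL ℝ V V ℝ).flip f) (C (f a))) b =
        C (f a) (f (b 0)) := fun a b => rfl
    rw [h1, ContinuousAlternatingMap.smul_apply,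
      ContinuousAlternatingMap.alternatizeUncurryFinCLM_apply,
      ContinuousAlternatingMap.alternatizeUncurryFin_apply, Fin.sum_univ_two]
    simp only [ContinuousLinearMap.comp_apply, h3, hC]
    have e0 : Fin.removeNth (0 : Fin 2) v 0 = v 1 := rfl
    have e1 : Fin.removeNth (1 : Fin 2) v 0 = v 0 := rfl
    rw [e0, e1, h2]
    simp
    ring
  rw [key]
  have hid : ContDiff ℝ ∞ fun f : V →L[ℝ] V => f := contDiff_id
  have h1 : ContDiff ℝ ∞ fun f : V →L[ℝ] V =>
      J.comp (((ContinuousLinearMap.compL ℝ V V ℝ).flip f).comp (C.comp f)) :=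
    contDiff_const.clm_comp (((ContinuousLinearMap.compL ℝ V V ℝ).flip.contDiff).clm_comp
      (contDiff_const.clm_comp hid))
  have h2 : ContDiff ℝ ∞
      (ContinuousAlternatingMap.alternatizeUncurryFinCLM (n := 1) ℝ V ℝ) :=
    ContinuousLinearMap.contDiff _
  exact (h2.comp h1).const_smul _

theorem extDeriv_const_eq_zero {n : ℕ} (Ω : V [⋀^Fin n]→L[ℝ] ℝ) (z : V) :
    extDeriv (fun _ : V => Ω) z = 0 := by
  ext v
  simp [extDeriv, ContinuousAlternatingMap.alternatizeUncurryFin_apply]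

/-- `i ∂∂̄` commutes with holomorphic changes of coordinates. -/
theorem iddbar_comp {u Q : V → ℝ} {f : V → V} {f' : V → V →L[ℝ] V} {f'' : V →L[ℝ] V →L[ℝ] V}
    {z : V} (hu : u =ᶠ[nhds z] fun z => Q (f z)) (hf : ∀ᶠ z in nhds z, HasFDerivAt f (f' z) z)
    (hf' : HasFDerivAt f' f'' z) (hQ : ContDiff ℝ ∞ Q)
    (hI : ∀ v, f' z (Complex.I • v) = Complex.I • f' z v)
    (hs : ∀ v w, f'' w (Complex.I • v) = f'' v (Complex.I • w)) (v w : V) :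
    iddbar u z v w = iddbar Q (f z) (f' z v) (f' z w) := by
  have hQ1 : ∀ x, HasFDerivAt Q (fderiv ℝ Q x) x := fun x =>
    (hQ.differentiable (by simp) x).hasFDerivAt
  have hQ2 : HasFDerivAt (fderiv ℝ Q) (fderiv ℝ (fderiv ℝ Q) (f z)) (f z) :=
    ((hQ.fderiv_right (m := 1) (WithTop.coe_le_coe.2 le_top)).differentiable
      (by simp) _).hasFDerivAt
  have h1 : fderiv ℝ u =ᶠ[nhds z] fun z => (fderiv ℝ Q (f z)).comp (f' z) := by
    filter_upwards [hu.eventuallyEq_nhds, hf] with x hx hfx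
    rw [hx.fderiv_eq]
    exact ((hQ1 (f x)).comp x hfx).fderiv
  have h2 := (hQ2.comp z hf.self_of_nhds).clm_comp hf'
  have h3 : fderiv ℝ (fderiv ℝ u) z = _ := (h2.congr_of_eventuallyEq h1).fderiv
  -- In the second-order chain rule the term DQ(f''(a, b)) is the only obstruction to invariance;
  -- `hs` makes it cancel in `iddbar`.
  have h4 : ∀ a b, fderiv ℝ (fderiv ℝ u) z a b =
      fderiv ℝ (fderiv ℝ Q) (f z) (f' z a) (f' z b) + fderiv ℝ Q (f z) (f'' a b) := by
    intro a b
    rw [h3]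
    simp [add_comm]
  simp only [iddbar, h4, hI, hs v w]
  ring

/-- `i ∂∂̄` of a quadratic function. -/
theorem iddbar_quadratic {E : Type*} [NormedAddCommGroup E] [NormedSpace ℝ E]
    (S : E →L[ℝ] E →L[ℝ] ℝ)
    (hS : ∀ a b, S a b = S b a) (A : V →L[ℝ] E) (y : E) (z v w : V) :
    iddbar (fun z => S (y + A z) (y + A z)) z v w =
      S (A w) (A (Complex.I • v)) - S (A v) (A (Complex.I • w)) := by
  have h0 : ∀ z, HasFDerivAt (fun z => y + A z) A z := fun z => A.hasFDerivAt.const_add y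
  have h1 : ∀ z, HasFDerivAt (fun z => S (y + A z) (y + A z))
      ((2 : ℝ) • (S (y + A z)).comp A) z := by
    intro z
    have h := (S.hasFDerivAt.comp z (h0 z)).clm_apply (h0 z)
    refine h.congr_fderiv ?_
    ext a
    simp only [add_apply, ContinuousLinearMap.comp_apply, ContinuousLinearMap.flip_apply,
      smul_apply, smul_eq_mul, Function.comp_apply]
    rw [hS (A a)]
    ring
  have h2 : fderiv ℝ (fun z => S (y + A z) (y + A z)) =
      fun z => (2 : ℝ) • (S (y + A z)).comp A := funext fun z => (h1 z).fderiv
  have h3 : HasFDerivAt (fun z => (2 : ℝ) • (S (y + A z)).comp A) _ z :=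
    ((S.hasFDerivAt.comp z (h0 z)).clm_comp (hasFDerivAt_const A z)).const_smul (2 : ℝ)
  simp only [iddbar, h2, h3.fderiv]
  simp
  ring

end Calculus

/-! ### Local branches of the coordinatewise logarithm -/

section Log

variable {r : ℕ}

/-- The branch of the coordinatewise logarithm on `(ℂ^*)^r` near `z₀`. -/
def logVec (z₀ z : Fin r → ℂ) : Fin r → ℂ := fun k => Complex.log (z k / z₀ k) + Complex.log (z₀ k)

/-- The differential `v ↦ v / z` of the coordinatewise logarithm. -/
def logDiff (z : Fin r → ℂ) : (Fin r → ℂ) →L[ℝ] (Fin r → ℂ) :=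
  ContinuousLinearMap.pi fun k => (z k)⁻¹ • ContinuousLinearMap.proj (R := ℝ) k

theorem logDiff_apply (z v : Fin r → ℂ) (k : Fin r) : logDiff z v k = (z k)⁻¹ * v k := rfl

theorem logDiff_I_smul (z v : Fin r → ℂ) :
    logDiff z (Complex.I • v) = Complex.I • logDiff z v := by
  ext k
  simp only [logDiff_apply, Pi.smul_apply, smul_eq_mul]
  ring

theorem logDiff_eq_zero {z v : Fin r → ℂ} (hz : z ∈ complexTorus r) (h : logDiff z v = 0) :
    v = 0 := by
  ext k
  have := congr_fun h k
  rw [logDiff_apply] at this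
  simpa [hz k] using this

theorem logDiff_surjective {z : Fin r → ℂ} (hz : z ∈ complexTorus r) :
    Function.Surjective (logDiff z) := fun w =>
  ⟨fun k => z k * w k, by
    ext k
    rw [logDiff_apply, inv_mul_cancel_left₀ (hz k)]⟩

theorem exp_logVec {z₀ z : Fin r → ℂ} (hz₀ : z₀ ∈ complexTorus r) (hz : z ∈ complexTorus r)
    (k : Fin r) : Complex.exp (logVec z₀ z k) = z k := by
  rw [logVec, Complex.exp_add, Complex.exp_log (div_ne_zero (hz k) (hz₀ k)),
    Complex.exp_log (hz₀ k), div_mul_cancel₀ _ (hz₀ k)]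

/-- Dividing by z₀ moves the base point to 1, away from the cut, so the principal logarithm serves
near every z₀. -/
theorem eventually_mem_slitPlane {z₀ : Fin r → ℂ} (hz₀ : z₀ ∈ complexTorus r) :
    ∀ᶠ z in nhds z₀, ∀ k, z k / z₀ k ∈ Complex.slitPlane := by
  refine Filter.eventually_all.2 fun k => ?_
  have hc : Continuous fun z : Fin r → ℂ => z k / z₀ k := (continuous_apply k).div_const _
  refine hc.continuousAt.preimage_mem_nhds (Complex.isOpen_slitPlane.mem_nhds ?_)
  rw [div_self (hz₀ k)]
  exact Complex.one_mem_slitPlane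

theorem contDiffAt_logVec {z₀ z : Fin r → ℂ} (h : ∀ k, z k / z₀ k ∈ Complex.slitPlane) :
    ContDiffAt ℝ ∞ (logVec z₀) z := by
  refine contDiffAt_pi.2 fun k => ?_
  have h1 : ContDiffAt ℝ ∞ (fun z : Fin r → ℂ => z k / z₀ k) z :=
    ((contDiff_apply ℝ ℂ k).div_const _).contDiffAt
  have h2 : ContDiffAt ℝ ∞ Complex.log (z k / z₀ k) :=
    (Complex.contDiffAt_log (h k)).restrict_scalars ℝ
  exact (ContDiffAt.comp z h2 h1).add contDiffAt_const

theorem hasFDerivAt_logVec {z₀ z : Fin r → ℂ} (hz₀ : z₀ ∈ complexTorus r)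
    (h : ∀ k, z k / z₀ k ∈ Complex.slitPlane) : HasFDerivAt (logVec z₀) (logDiff z) z := by
  refine hasFDerivAt_pi.2 fun k => ?_
  have h1 : HasFDerivAt (fun z : Fin r → ℂ => z k / z₀ k)
      ((z₀ k)⁻¹ • (ContinuousLinearMap.proj (R := ℝ) k : (Fin r → ℂ) →L[ℝ] ℂ)) z := by
    simp only [div_eq_inv_mul]
    exact (hasFDerivAt_apply k z).const_smul ((z₀ k)⁻¹)
  have h2 := ((Complex.hasStrictFDerivAt_log_real (h k)).hasFDerivAt.comp z h1).add_const
    (Complex.log (z₀ k))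
  refine h2.congr_fderiv ?_
  ext v
  have : z k ≠ 0 := fun h0 => Complex.slitPlane_ne_zero (h k) (by rw [h0, zero_div])
  simp
  field_simp [hz₀ k]

/-- The diagonal endomorphisms of `ℂ^r`. -/
def diagMap (r : ℕ) : (Fin r → ℂ) →L[ℝ] (Fin r → ℂ) →L[ℝ] (Fin r → ℂ) :=
  LinearMap.toContinuousLinearMap
    { toFun := fun a => ContinuousLinearMap.pi fun k => a k • ContinuousLinearMap.proj (R := ℝ) k
      map_add' := fun a b => by
        ext v k
        simp [add_mul]
      map_smul' := fun c a => by
        ext v k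
        simp [mul_assoc] }

theorem diagMap_apply (a v : Fin r → ℂ) (k : Fin r) : diagMap r a v k = a k * v k := rfl

theorem contDiffAt_logDiff {z : Fin r → ℂ} (hz : z ∈ complexTorus r) :
    ContDiffAt ℝ ∞ (logDiff (r := r)) z := by
  refine (diagMap r).contDiff.contDiffAt.comp z (contDiffAt_pi.2 fun k => ?_)
  exact (contDiff_apply ℝ ℂ k).contDiffAt.inv (hz k)

/-- The second derivative -wv/z² is symmetric and complex bilinear, which is what `iddbar_comp`
needs of a change of coordinates. -/
theorem fderiv_logDiff {z : Fin r → ℂ} (hz : z ∈ complexTorus r) (w v : Fin r → ℂ) (k : Fin r) :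
    fderiv ℝ logDiff z w v k = -(z k ^ 2)⁻¹ * w k * v k := by
  have h1 : ∀ k, HasFDerivAt (fun z : Fin r → ℂ => (z k)⁻¹)
      (-(z k ^ 2)⁻¹ • (ContinuousLinearMap.proj (R := ℝ) k : (Fin r → ℂ) →L[ℝ] ℂ)) z := by
    intro k
    have h := ((hasDerivAt_inv (hz k)).hasFDerivAt.restrictScalars ℝ).comp z
      (hasFDerivAt_apply (𝕜 := ℝ) k z)
    refine h.congr_fderiv ?_
    ext v
    simp [mul_comm]
  have h2 : HasFDerivAt (logDiff (r := r)) _ z :=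
    (diagMap r).hasFDerivAt.comp z (hasFDerivAt_pi.2 h1)
  rw [h2.fderiv, ContinuousLinearMap.comp_apply, diagMap_apply]
  simp

end Log

/-! ### The global chart of a leaf and the differential of the inclusion -/

section LeafChart

variable {E : Type*} [NormedAddCommGroup E] [NormedSpace ℝ E]
variable {G : Type*} [TopologicalSpace G] [ChartedSpace E G] [Group G] {r : ℕ}
variable [LieGroup 𝓘(ℝ, E) ∞ G] [T2Space G]
variable {T : Torus E G r} {F : E →ₗ[ℝ] E}

/-- The global chart of a leaf, with values in the complex torus. -/
def TorusSection.leafChart (K : TorusSection T F) {σ : ℂ} (hσ : σ.im ≠ 0) (x : G) (y : E)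
    (p : T.leaf x y) : Fin r → ℂ :=
  ((K.leafHomeomorph hσ x y).symm p).1

variable (K : TorusSection T F) {σ : ℂ} (hσ : σ.im ≠ 0) (x : G) (y : E)

theorem TorusSection.leafChart_mem (p : T.leaf x y) : K.leafChart hσ x y p ∈ complexTorus r :=
  ((K.leafHomeomorph hσ x y).symm p).2

theorem TorusSection.leafHomeomorph_leafChart (p : T.leaf x y) :
    K.leafHomeomorph hσ x y ⟨K.leafChart hσ x y p, K.leafChart_mem hσ x y p⟩ = p :=
  (K.leafHomeomorph hσ x y).apply_symm_apply p

theorem TorusSection.isOpenEmbedding_leafChart :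
    Topology.IsOpenEmbedding (K.leafChart hσ x y) :=
  (complexTorus r).isOpenEmbedding'.comp (K.leafHomeomorph hσ x y).symm.isOpenEmbedding

theorem TorusSection.range_leafChart :
    Set.range (K.leafChart hσ x y) = (complexTorus r : Set (Fin r → ℂ)) := by
  ext z
  constructor
  · rintro ⟨p, rfl⟩
    exact K.leafChart_mem hσ x y p
  · intro hz
    refine ⟨K.leafHomeomorph hσ x y ⟨z, hz⟩, ?_⟩
    rw [TorusSection.leafChart, Homeomorph.symm_apply_apply]

omit [LieGroup 𝓘(ℝ, E) ∞ G] [T2Space G] in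
variable (T) in
theorem Torus.nonempty_leaf : Nonempty (T.leaf x y) :=
  ⟨⟨(x, y), T.mem_fiber_iff.2 ⟨0, by rw [T.exp_zero, mul_one]⟩, 0, T.lieAlgebra.zero_mem,
    add_zero y⟩⟩

/-- The complex manifold structure of a leaf. -/
abbrev TorusSection.leafChartedSpace : ChartedSpace (Fin r → ℂ) (T.leaf x y) :=
  have := T.nonempty_leaf x y
  (K.isOpenEmbedding_leafChart hσ x y).singletonChartedSpace

/-- For any base point z₀ this holds on the whole leaf, since `logVec` is a right inverse of exp
even across the cut; only its differentiability is local. The inclusion thus factors through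
`logParam`. -/
theorem TorusSection.leaf_eq_logParam (p : T.leaf x y) {z₀ : Fin r → ℂ}
    (hz₀ : z₀ ∈ complexTorus r) :
    (p : G × E) = K.logParam σ x y (logVec z₀ (K.leafChart hσ x y p)) := by
  rw [← K.leafHomeomorph_eq_logParam hσ x y ⟨_, K.leafChart_mem hσ x y p⟩ _
    (exp_logVec hz₀ (K.leafChart_mem hσ x y p)), K.leafHomeomorph_leafChart]

omit [T2Space G] in
theorem TorusSection.contMDiff_logParam :
    ContMDiff 𝓘(ℝ, Fin r → ℂ) (𝓘(ℝ, E).prod 𝓘(ℝ, E)) ∞ (K.logParam σ x y) := by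
  have h1 : ContDiff ℝ ∞ fun ξ : Fin r → ℂ => imVec r ξ + (σ.re / σ.im) • reVec r ξ :=
    (imVec r + (σ.re / σ.im) • reVec r).contDiff
  have h2 : ContDiff ℝ ∞ fun ξ : Fin r → ℂ => y + -(σ.im⁻¹ • K.map (reVec r ξ)) :=
    contDiff_const.add (-(σ.im⁻¹ • K.map.comp (reVec r))).contDiff
  exact (contMDiff_const.mul (T.contMDiff_exp.comp h1.contMDiff)).prodMk h2.contMDiff

omit [T2Space G] in
theorem TorusSection.hasDifferential_logParam (ξ : Fin r → ℂ) :
    HasDifferential 𝓘(ℝ, Fin r → ℂ) (𝓘(ℝ, E).prod 𝓘(ℝ, E)) (K.logParam σ x y) ξ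
      ((((leftTransl (K.logParam σ x y ξ).1).comp T.dexp).comp
        (imVec r + (σ.re / σ.im) • reVec r)).prod (-(σ.im⁻¹ • K.map.comp (reVec r)))) := by
  have h1 : HasFDerivAt (fun ξ : Fin r → ℂ => imVec r ξ + (σ.re / σ.im) • reVec r ξ)
      (imVec r + (σ.re / σ.im) • reVec r) ξ := (imVec r + (σ.re / σ.im) • reVec r).hasFDerivAt
  have h2 : HasFDerivAt (fun ξ : Fin r → ℂ => y + -(σ.im⁻¹ • K.map (reVec r ξ)))
      (-(σ.im⁻¹ • K.map.comp (reVec r))) ξ :=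
    (-(σ.im⁻¹ • K.map.comp (reVec r))).hasFDerivAt.const_add y
  exact ((T.hasDifferential_mul_exp x _).comp (hasDifferential_iff_hasFDerivAt.2 h1) rfl).prodMk
    (hasDifferential_iff_hasFDerivAt.2 h2)

theorem TorusSection.contMDiff_val :
    letI := K.leafChartedSpace hσ x y
    ContMDiff 𝓘(ℝ, Fin r → ℂ) (𝓘(ℝ, E).prod 𝓘(ℝ, E)) ∞ (Subtype.val : T.leaf x y → G × E) := by
  let := K.leafChartedSpace hσ x y
  have := T.nonempty_leaf x y
  intro p
  have hp := K.leafChart_mem hσ x y p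
  have h1 : ContMDiff 𝓘(ℝ, Fin r → ℂ) 𝓘(ℝ, Fin r → ℂ) ∞ (K.leafChart hσ x y) :=
    contMDiff_isOpenEmbedding (K.isOpenEmbedding_leafChart hσ x y)
  have h2 : ContDiffAt ℝ ∞ (logVec (K.leafChart hσ x y p)) (K.leafChart hσ x y p) :=
    contDiffAt_logVec (eventually_mem_slitPlane hp).self_of_nhds
  have h3 := K.contMDiff_logParam (σ := σ) x y
  have h4 := h3.contMDiffAt.comp p (h2.contMDiffAt.comp p h1.contMDiffAt)
  refine h4.congr_of_eventuallyEq (Filter.Eventually.of_forall fun q => ?_)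
  exact K.leaf_eq_logParam hσ x y q hp

/-- The left trivialization cancels the left translation in the differential of `logParam`, so the
point enters only through the derivative of the logarithm. -/
theorem TorusSection.triv_dIncl (p : T.leaf x y) (v : Fin r → ℂ) :
    letI := K.leafChartedSpace hσ x y
    triv p.1 (dIncl (V := Fin r → ℂ) (T.leaf x y) p v) =
      leafTangent σ T.dexp K.map (logDiff (K.leafChart hσ x y p) v) := by
  let := K.leafChartedSpace hσ x y
  have := T.nonempty_leaf x y
  have hp := K.leafChart_mem hσ x y p
  have h1 := hasDifferential_chart (K.isOpenEmbedding_leafChart hσ x y) p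
  have h2 := hasFDerivAt_logVec hp (eventually_mem_slitPlane hp).self_of_nhds
  have h3 := (K.hasDifferential_logParam (σ := σ) x y _).comp
    ((hasDifferential_iff_hasFDerivAt.2 h2).comp h1 rfl) rfl
  have h4 := h3.congr (g := (Subtype.val : T.leaf x y → G × E))
    (Filter.Eventually.of_forall fun q => K.leaf_eq_logParam hσ x y q hp)
  have h5 : dIncl (V := Fin r → ℂ) (T.leaf x y) p = _ := h4.differential_eq
  rw [h5, ← K.leaf_eq_logParam hσ x y p hp]
  simp [triv, leftTriv_leftTransl, leafTangent]

end LeafChart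

/-! ### The Kähler form and the potential in logarithmic coordinates -/

section LeafForm

variable {E : Type*} [NormedAddCommGroup E] [NormedSpace ℝ E] [FiniteDimensional ℝ E]
variable {G : Type*} [TopologicalSpace G] [ChartedSpace E G] [Group G] {r : ℕ}
variable [LieGroup 𝓘(ℝ, E) ∞ G]
variable {T : Torus E G r} {F : E →ₗ[ℝ] E} {B : InvariantInner (E := E) G}

/-- The Kähler form of a leaf in logarithmic coordinates. -/
def TorusSection.leafForm (B : InvariantInner (E := E) G) (K : TorusSection T F) (σ : ℂ) :
    (Fin r → ℂ) [⋀^Fin 2]→L[ℝ] ℝ :=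
  (omegaTriv B 0).compContinuousLinearMap (leafTangent σ T.dexp K.map)

variable (K : TorusSection T F) {σ : ℂ}

/-- On the tangent spaces of the leaves, the canonical form does not depend on the point. -/
theorem TorusSection.omegaTriv_leafTangent (y : E) (a : Fin 2 → Fin r → ℂ) :
    omegaTriv B y (fun i => leafTangent σ T.dexp K.map (a i)) =
      K.leafForm B σ a := by
  have h : ∀ ξ, (leafTangent σ T.dexp K.map ξ).1 ∈ T.lieAlgebra := fun ξ => T.dexp_mem _
  -- The bracket term is the only one that involves `y`, and both first components lie in 𝔱.
  have hb : bracket G (leafTangent σ T.dexp K.map (a 0)).1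
      (leafTangent σ T.dexp K.map (a 1)).1 = 0 :=
    have := FiniteDimensional.complete ℝ E
    Torus.bracket_eq_zero (h _) (h _)
  have h1 : ∀ y : E, omegaTriv B y (fun i => leafTangent σ T.dexp K.map (a i)) =
      B.form (leafTangent σ T.dexp K.map (a 0)).1 (leafTangent σ T.dexp K.map (a 1)).2 -
      B.form (leafTangent σ T.dexp K.map (a 0)).2 (leafTangent σ T.dexp K.map (a 1)).1 +
      B.form y (bracket G (leafTangent σ T.dexp K.map (a 0)).1
        (leafTangent σ T.dexp K.map (a 1)).1) := fun y => rfl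
  refine (h1 y).trans (Eq.trans ?_ (h1 0).symm)
  rw [hb, map_zero, map_zero]

-- The form ⟨Ku, dexp v⟩ = ⟨Ku, FKv⟩ is the pullback to ℝ^r of the symmetric form ⟨·, F·⟩ on 𝔱.
omit [FiniteDimensional ℝ E] [LieGroup 𝓘(ℝ, E) ∞ G] in
theorem TorusSection.form_map_dexp_comm (hF : IsTorusQuadratic B T F) (u v : Fin r → ℝ) :
    B.form (K.map u) (T.dexp v) = B.form (K.map v) (T.dexp u) := by
  rw [← K.apply_map, ← hF.selfAdjoint, B.symm, K.apply_map]

omit [FiniteDimensional ℝ E] [LieGroup 𝓘(ℝ, E) ∞ G] in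
theorem TorusSection.form_map_dexp_nonneg (hF : IsTorusQuadratic B T F) (u : Fin r → ℝ) :
    0 ≤ B.form (K.map u) (T.dexp u) := by
  rw [← K.apply_map]
  by_cases h : K.map u = 0
  · simp [h]
  · exact (hF.pos _ (K.mem u) h).le

omit [FiniteDimensional ℝ E] in
theorem TorusSection.form_map_dexp_pos (hF : IsTorusQuadratic B T F) {u : Fin r → ℝ}
    (hu : u ≠ 0) : 0 < B.form (K.map u) (T.dexp u) := by
  rw [← K.apply_map]
  exact hF.pos _ (K.mem u) fun h => hu (K.map_injective (h.trans (map_zero _).symm))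

/-- The terms with σ₁ involve only Re a and Re b and cancel by symmetry of ⟨Ku, dexp v⟩. -/
theorem TorusSection.leafForm_apply (hF : IsTorusQuadratic B T F) (a b : Fin r → ℂ) :
    K.leafForm B σ ![a, b] = σ.im⁻¹ * (B.form (K.map (reVec r a)) (T.dexp (imVec r b)) -
      B.form (K.map (reVec r b)) (T.dexp (imVec r a))) := by
  have h1 : K.leafForm B σ ![a, b] =
      B.form (leafTangent σ T.dexp K.map a).1 (leafTangent σ T.dexp K.map b).2 -
      B.form (leafTangent σ T.dexp K.map a).2 (leafTangent σ T.dexp K.map b).1 +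
      B.form 0 (bracket G (leafTangent σ T.dexp K.map a).1
        (leafTangent σ T.dexp K.map b).1) := rfl
  rw [h1, leafTangent_apply, leafTangent_apply]
  simp only [map_add, map_neg, map_smul, LinearMap.add_apply, LinearMap.neg_apply,
    LinearMap.smul_apply, map_zero, LinearMap.zero_apply, smul_eq_mul]
  rw [B.symm (T.dexp _) (K.map _), B.symm (T.dexp _) (K.map _),
    K.form_map_dexp_comm hF (reVec r b) (reVec r a)]
  ring

theorem TorusSection.leafForm_I_smul (hF : IsTorusQuadratic B T F) (a b : Fin r → ℂ) :
    K.leafForm B σ ![Complex.I • a, Complex.I • b] = K.leafForm B σ ![a, b] := by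
  rw [K.leafForm_apply hF, K.leafForm_apply hF]
  simp only [reVec_I_smul, imVec_I_smul, map_neg, LinearMap.neg_apply]
  rw [K.form_map_dexp_comm hF (imVec r a), K.form_map_dexp_comm hF (imVec r b)]
  ring

/-- The value is σ₂⁻¹ times the sum of the squared lengths of Re a and Im a in the inner product
⟨Ku, FKv⟩. -/
theorem TorusSection.leafForm_pos (hF : IsTorusQuadratic B T F) (hσ : 0 < σ.im) {a : Fin r → ℂ}
    (ha : a ≠ 0) : 0 < K.leafForm B σ ![a, Complex.I • a] := by
  rw [K.leafForm_apply hF]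
  simp only [reVec_I_smul, imVec_I_smul, map_neg, LinearMap.neg_apply, sub_neg_eq_add]
  refine mul_pos (inv_pos.2 hσ) ?_
  by_cases h : reVec r a = 0
  · refine add_pos_of_nonneg_of_pos (K.form_map_dexp_nonneg hF _) (K.form_map_dexp_pos hF ?_)
    intro h'
    refine ha (funext fun k => Complex.ext ?_ ?_)
    · exact congr_fun h k
    · exact congr_fun h' k
  · exact add_pos_of_pos_of_nonneg (K.form_map_dexp_pos hF h) (K.form_map_dexp_nonneg hF _)

/-- The Kähler potential in logarithmic coordinates. -/
theorem TorusSection.iddbar_hamiltonian (hF : IsTorusQuadratic B T F) (hσ : σ.im ≠ 0) (x : G)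
    (y : E) (ξ a b : Fin r → ℂ) :
    iddbar (fun ξ => 2 * σ.im * hamiltonian B F (K.logParam σ x y ξ)) ξ a b =
      K.leafForm B σ ![a, b] ∧
    ContDiff ℝ ∞ fun ξ : Fin r → ℂ => 2 * σ.im * hamiltonian B F (K.logParam σ x y ξ) := by
  -- With S = σ₂⟨·, F·⟩ and A = -σ₂⁻¹K Re, the function 2σ₂f becomes S(y + Aξ, y + Aξ), so its
  -- Hessian does not depend on `y`.
  let S : E →L[ℝ] E →L[ℝ] ℝ := LinearMap.toContinuousLinearMap
    ((LinearMap.toContinuousLinearMap : (E →ₗ[ℝ] ℝ) ≃ₗ[ℝ] (E →L[ℝ] ℝ)).toLinearMap.comp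
      (σ.im • B.form.compl₂ F))
  have hS : ∀ a b, S a b = σ.im * B.form a (F b) := fun a b => rfl
  let A : (Fin r → ℂ) →L[ℝ] E := -(σ.im⁻¹ • K.map.comp (reVec r))
  have hA : ∀ a, A a = -(σ.im⁻¹ • K.map (reVec r a)) := fun a => rfl
  have hQ : (fun ξ => 2 * σ.im * hamiltonian B F (K.logParam σ x y ξ)) =
      fun ξ => S (y + A ξ) (y + A ξ) := by
    funext ξ
    rw [hS]
    simp only [hamiltonian, TorusSection.logParam, hA]
    ring
  rw [hQ]
  constructor
  · rw [iddbar_quadratic S (fun a b => by rw [hS, hS, ← hF.selfAdjoint, B.symm]), hS, hS,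
      K.leafForm_apply hF]
    simp only [hA, reVec_I_smul, map_neg, map_smul, K.apply_map, smul_neg, neg_neg,
      LinearMap.neg_apply, LinearMap.smul_apply, smul_eq_mul]
    field_simp
    ring
  · have h1 : ContDiff ℝ ∞ fun ξ => y + A ξ := contDiff_const.add A.contDiff
    exact (S.contDiff.comp h1).clm_apply h1

end LeafForm

/-! ### Assembly of the four properties of a leaf -/

section Assembly

variable {E : Type*} [NormedAddCommGroup E] [NormedSpace ℝ E]
variable {G : Type*} [TopologicalSpace G] [ChartedSpace E G] [Group G] {r : ℕ}
variable [LieGroup 𝓘(ℝ, E) ∞ G] [T2Space G]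
variable {T : Torus E G r} {F : E →ₗ[ℝ] E} {B : InvariantInner (E := E) G}
variable (K : TorusSection T F) {σ : ℂ} (hσ : σ.im ≠ 0) (x : G) (y : E)

theorem TorusSection.isEmbeddedComplexManifold :
    letI := K.leafChartedSpace hσ x y
    IsEmbeddedComplexManifold (V := Fin r → ℂ) (T.leaf x y) := by
  let := K.leafChartedSpace hσ x y
  have := T.nonempty_leaf x y
  refine ⟨(K.isOpenEmbedding_leafChart hσ x y).isManifold_singleton, K.contMDiff_val hσ x y,
    fun p => (injective_iff_map_eq_zero _).2 fun v hv => ?_⟩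
  have h := K.triv_dIncl hσ x y p v
  rw [hv, map_zero, leafTangent_apply] at h
  -- The second component of `leafTangent` determines Re; once Re = 0, the first component
  -- determines Im.
  have h1 : reVec r (logDiff (K.leafChart hσ x y p) v) = 0 := by
    have h2 := (congr_arg Prod.snd h).symm
    simp only [Prod.snd_zero, neg_eq_zero, smul_eq_zero, inv_eq_zero, hσ, false_or] at h2
    exact K.map_injective (h2.trans (map_zero _).symm)
  have h3 : imVec r (logDiff (K.leafChart hσ x y p) v) = 0 := by
    have h2 := (congr_arg Prod.fst h).symm
    rw [h1] at h2
    simp only [map_zero, smul_zero, add_zero, Prod.fst_zero] at h2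
    exact T.dexp_injective (h2.trans (map_zero _).symm)
  refine logDiff_eq_zero (K.leafChart_mem hσ x y p) (funext fun k => Complex.ext ?_ ?_)
  · exact congr_fun h1 k
  · exact congr_fun h3 k

theorem TorusSection.holTangent_eq (hF : IsTorusQuadratic B T F) (p : T.leaf x y) :
    letI := K.leafChartedSpace hσ x y
    holTangent (V := Fin r → ℂ) (T.leaf x y) p =
      (tPart T σ F : Set ((ℂ ⊗[ℝ] E) × (ℂ ⊗[ℝ] E))) := by
  let := K.leafChartedSpace hσ x y
  rw [tPart_eq_range hσ hF K]
  have h : ∀ v : Fin r → ℂ, cplx (triv p.1 (dIncl (V := Fin r → ℂ) (T.leaf x y) p v))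
      (-triv p.1 (dIncl (V := Fin r → ℂ) (T.leaf x y) p (Complex.I • v))) =
      cplx (leafTangent σ T.dexp K.map (logDiff (K.leafChart hσ x y p) v))
        (-leafTangent σ T.dexp K.map (Complex.I • logDiff (K.leafChart hσ x y p) v)) := by
    intro v
    rw [← logDiff_I_smul, ← K.triv_dIncl hσ x y p v, ← K.triv_dIncl hσ x y p (Complex.I • v)]
  simp only [holTangent, h]
  exact (logDiff_surjective (K.leafChart_mem hσ x y p)).range_comp fun ξ =>
    cplx (leafTangent σ T.dexp K.map ξ) (-leafTangent σ T.dexp K.map (Complex.I • ξ))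

/-- The holomorphic chart of a leaf as a diffeomorphism onto the complex torus. -/
theorem TorusSection.exists_diffeomorph :
    letI := K.leafChartedSpace hσ x y
    ∃ Φ : Diffeomorph 𝓘(ℂ, Fin r → ℂ) 𝓘(ℂ, Fin r → ℂ) (T.leaf x y) (complexTorus r) ω,
      ∀ p, (Φ p).1 = K.leafChart hσ x y p := by
  let := K.leafChartedSpace hσ x y
  have := T.nonempty_leaf x y
  refine ⟨⟨(K.leafHomeomorph hσ x y).symm.toEquiv, ?_, ?_⟩, fun p => rfl⟩
  · intro p
    have h1 : ContMDiff 𝓘(ℂ, Fin r → ℂ) 𝓘(ℂ, Fin r → ℂ) ω (K.leafChart hσ x y) :=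
      contMDiff_isOpenEmbedding (K.isOpenEmbedding_leafChart hσ x y)
    have h2 := h1 p
    rw [← contMDiffWithinAt_univ] at h2 ⊢
    exact (ChartedSpace.liftPropWithinAt_subtypeVal_comp_iff ..).1 h2
  -- Followed by the chart, the inverse map is the inclusion of (ℂ^*)^r in ℂ^r.
  · refine ContMDiff.of_comp_isOpenEmbedding (K.isOpenEmbedding_leafChart hσ x y) ?_
    have h : K.leafChart hσ x y ∘ (K.leafHomeomorph hσ x y) = Subtype.val := by
      funext z
      simp only [Function.comp_apply, TorusSection.leafChart, Homeomorph.symm_apply_apply]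
    have h' : ContMDiff 𝓘(ℂ, Fin r → ℂ) 𝓘(ℂ, Fin r → ℂ) ω
        (K.leafChart hσ x y ∘ (K.leafHomeomorph hσ x y)) := by
      rw [h]
      exact contMDiff_subtype_val
    exact h'

theorem TorusSection.leafChart_smul (t : Fin r → Circle) {p q : T.leaf x y}
    (h : q.1 = (p.1.1 * T.hom t, p.1.2)) (k : Fin r) :
    K.leafChart hσ x y q k = (t k : ℂ) * K.leafChart hσ x y p k := by
  have hp := K.leafChart_mem hσ x y p
  let w : complexTorus r := ⟨fun k => t k * K.leafChart hσ x y p k, fun k =>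
    mul_ne_zero (Circle.coe_ne_zero _) (hp k)⟩
  have h1 := K.leafHomeomorph_smul hσ x y t ⟨_, hp⟩ w fun _ => rfl
  rw [K.leafHomeomorph_leafChart, ← h] at h1
  have h2 : K.leafHomeomorph hσ x y w = q := Subtype.ext h1
  rw [← h2, TorusSection.leafChart, Homeomorph.symm_apply_apply]

variable [FiniteDimensional ℝ E]

theorem TorusSection.pullbackOmega_eq (p : T.leaf x y) :
    letI := K.leafChartedSpace hσ x y
    pullbackOmega (V := Fin r → ℂ) B (T.leaf x y) p =
      (K.leafForm B σ).compContinuousLinearMap (logDiff (K.leafChart hσ x y p)) := by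
  let := K.leafChartedSpace hσ x y
  ext a
  have h1 : pullbackOmega (V := Fin r → ℂ) B (T.leaf x y) p a = omegaTriv B p.1.2
      fun i => triv p.1 (dIncl (V := Fin r → ℂ) (T.leaf x y) p (a i)) := rfl
  have h : (fun i => leafTangent σ T.dexp K.map (logDiff (K.leafChart hσ x y p) (a i))) =
      fun i => triv p.1 (dIncl (V := Fin r → ℂ) (T.leaf x y) p (a i)) :=
    funext fun i => (K.triv_dIncl hσ x y p (a i)).symm
  rw [h1, ← h, K.omegaTriv_leafTangent]
  rfl

/-- The atlas has one chart, whose inverse has identity differential, so the local expression is the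
constant form pulled back by `logDiff z`. -/
theorem TorusSection.chartForm_eq {e : OpenPartialHomeomorph (T.leaf x y) (Fin r → ℂ)}
    (he : e ∈ (K.leafChartedSpace hσ x y).atlas) {z : Fin r → ℂ} (hz : z ∈ e.target) :
    letI := K.leafChartedSpace hσ x y
    z ∈ complexTorus r ∧ K.leafChart hσ x y (e.symm z) = z ∧
    chartForm (pullbackOmega (V := Fin r → ℂ) B (T.leaf x y)) e z =
      (K.leafForm B σ).compContinuousLinearMap (logDiff z) := by
  have := T.nonempty_leaf x y
  let := K.leafChartedSpace hσ x y
  have he' : e = (K.isOpenEmbedding_leafChart hσ x y).toOpenPartialHomeomorph := he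
  subst he'
  have hr : z ∈ Set.range (K.leafChart hσ x y) := by simpa using hz
  have h1 : K.leafChart hσ x y (((K.isOpenEmbedding_leafChart hσ x y).toOpenPartialHomeomorph).symm
      z) = z := (K.isOpenEmbedding_leafChart hσ x y).toOpenPartialHomeomorph_right_inv _ hr
  refine ⟨by rwa [K.range_leafChart] at hr, h1, ?_⟩
  have h2 := (hasDifferential_chart_symm (K.isOpenEmbedding_leafChart hσ x y) hr).differential_eq
  have h3 : chartForm (pullbackOmega (V := Fin r → ℂ) B (T.leaf x y))
      (K.isOpenEmbedding_leafChart hσ x y).toOpenPartialHomeomorph z =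
      (pullbackOmega (V := Fin r → ℂ) B (T.leaf x y)
        ((K.isOpenEmbedding_leafChart hσ x y).toOpenPartialHomeomorph.symm
          z)).compContinuousLinearMap (differential 𝓘(ℝ, Fin r → ℂ) 𝓘(ℝ, Fin r → ℂ)
            (K.isOpenEmbedding_leafChart hσ x y).toOpenPartialHomeomorph.symm z) := rfl
  rw [h3, h2, K.pullbackOmega_eq hσ x y, h1]
  rfl

theorem TorusSection.isKahlerForm (hF : IsTorusQuadratic B T F) (hσ' : 0 < σ.im) :
    letI := K.leafChartedSpace hσ x y
    IsKahlerForm (V := Fin r → ℂ) (pullbackOmega B (T.leaf x y)) := by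
  let := K.leafChartedSpace hσ x y
  have hΩ : ∀ p (v w : Fin r → ℂ), pullbackOmega (V := Fin r → ℂ) B (T.leaf x y) p ![v, w] =
      K.leafForm B σ ![logDiff (K.leafChart hσ x y p) v, logDiff (K.leafChart hσ x y p) w] := by
    intro p v w
    rw [K.pullbackOmega_eq hσ x y, ContinuousAlternatingMap.compContinuousLinearMap_apply]
    congr 1
    ext i
    fin_cases i <;> rfl
  refine ⟨fun e he => ?_, fun e he z hz => ?_, fun p v w => ?_, fun p v hv => ?_⟩
  · have h1 : ContDiffOn ℝ ∞ (fun z => (K.leafForm B σ).compContinuousLinearMap (logDiff z))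
        e.target := fun z hz => ((contDiff_compContinuousLinearMap (K.leafForm B σ)).contDiffAt.comp
          z (contDiffAt_logDiff (K.chartForm_eq (B := B) hσ x y he hz).1)).contDiffWithinAt
    exact h1.congr fun z hz => (K.chartForm_eq hσ x y he hz).2.2
  · have hz0 := (K.chartForm_eq (B := B) hσ x y he hz).1
    -- Near z, `logDiff` is the derivative of the branch `logVec z`; the local expression is thus
    -- the pullback of a constant form by a smooth map, and d commutes with pullback.
    have h1 : chartForm (pullbackOmega (V := Fin r → ℂ) B (T.leaf x y)) e =ᶠ[nhds z]
        fun w => (K.leafForm B σ).compContinuousLinearMap (fderiv ℝ (logVec z) w) := by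
      filter_upwards [e.open_target.mem_nhds hz, eventually_mem_slitPlane hz0] with w hw hw'
      rw [(K.chartForm_eq hσ x y he hw).2.2, (hasFDerivAt_logVec hz0 hw').fderiv]
    rw [h1.extDeriv_eq]
    have h0 : DifferentiableAt ℝ (fun _ : Fin r → ℂ => K.leafForm B σ) (logVec z z) :=
      differentiableAt_const _
    have h2 := extDeriv_pullback h0
      (contDiffAt_logVec (eventually_mem_slitPlane hz0).self_of_nhds) (r := ∞)
      (by rw [minSmoothness_of_isRCLikeNormedField]; exact WithTop.coe_le_coe.2 le_top)
    refine h2.trans ?_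
    rw [extDeriv_const_eq_zero]
    rfl
  · rw [hΩ, hΩ, logDiff_I_smul, logDiff_I_smul, K.leafForm_I_smul hF]
  · rw [hΩ, logDiff_I_smul]
    exact K.leafForm_pos hF hσ' fun h => hv (logDiff_eq_zero (K.leafChart_mem hσ x y p) h)

theorem TorusSection.isKahlerPotential (hF : IsTorusQuadratic B T F) :
    letI := K.leafChartedSpace hσ x y
    IsKahlerPotential (V := Fin r → ℂ) (pullbackOmega B (T.leaf x y))
      (fun p => 2 * σ.im * hamiltonian B F p.1) := by
  have := T.nonempty_leaf x y
  let := K.leafChartedSpace hσ x y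
  -- Smoothness does not depend on the point or the two vectors, so zeros are supplied.
  have hQ := (K.iddbar_hamiltonian hF hσ x y 0 0 0).2
  refine ⟨fun p => ?_, fun e he z hz v w => ?_⟩
  · have hp := K.leafChart_mem hσ x y p
    have h1 : ContMDiff 𝓘(ℝ, Fin r → ℂ) 𝓘(ℝ, Fin r → ℂ) ∞ (K.leafChart hσ x y) :=
      contMDiff_isOpenEmbedding (K.isOpenEmbedding_leafChart hσ x y)
    have h2 : ContDiffAt ℝ ∞ (logVec (K.leafChart hσ x y p)) (K.leafChart hσ x y p) :=
      contDiffAt_logVec (eventually_mem_slitPlane hp).self_of_nhds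
    have h4 := hQ.contMDiff.contMDiffAt.comp p (h2.contMDiffAt.comp p h1.contMDiffAt)
    refine h4.congr_of_eventuallyEq (Filter.Eventually.of_forall fun q => ?_)
    simp only [Function.comp_apply]
    rw [← K.leaf_eq_logParam hσ x y q hp]
  · obtain ⟨hz0, -, h1⟩ := K.chartForm_eq (B := B) hσ x y he hz
    have h2 : (K.leafForm B σ).compContinuousLinearMap (logDiff z) ![v, w] =
        K.leafForm B σ ![logDiff z v, logDiff z w] := by
      rw [ContinuousAlternatingMap.compContinuousLinearMap_apply]
      congr 1
      ext i
      fin_cases i <;> rfl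
    rw [h1, h2, ← (K.iddbar_hamiltonian hF hσ x y (logVec z z) _ _).1]
    symm
    -- The identity between the potential and the form, known in ξ, is carried to z by the
    -- holomorphic change of coordinates `logVec z`.
    refine iddbar_comp (f := logVec z) (f' := logDiff) ?_ ?_
      ((contDiffAt_logDiff hz0).differentiableAt (by simp)).hasFDerivAt hQ (logDiff_I_smul z) ?_ v w
    · filter_upwards [e.open_target.mem_nhds hz] with q hq
      rw [K.leaf_eq_logParam hσ x y _ hz0, (K.chartForm_eq (B := B) hσ x y he hq).2.1]
    · filter_upwards [eventually_mem_slitPlane hz0] with q hq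
      exact hasFDerivAt_logVec hz0 hq
    · intro v w
      ext k
      rw [fderiv_logDiff hz0, fderiv_logDiff hz0]
      simp only [Pi.smul_apply, smul_eq_mul]
      ring

end Assembly

end KahlerLeaves

end

theorem mainTheorem6
    {E : Type*} [NormedAddCommGroup E] [NormedSpace ℝ E] [FiniteDimensional ℝ E]
    {G : Type*} [TopologicalSpace G] [ChartedSpace E G] [Group G] [LieGroup 𝓘(ℝ, E) ∞ G]
    [T2Space G] [CompactSpace G] [ConnectedSpace G]
    (B : KahlerLeaves.InvariantInner (E := E) G)
    {r : ℕ} (T : KahlerLeaves.Torus E G r) (hT : T.IsMaximal)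
    (F : E →ₗ[ℝ] E) (hF : KahlerLeaves.IsTorusQuadratic B T F)
    (σ : ℂ) (hσ : 0 < σ.im) (x : G) (y : E) :
    T.leaf x y = KahlerLeaves.leafThrough
      (KahlerLeaves.realDistribution (KahlerLeaves.tPart T σ F)) (x, y) ∧
    ∃ _ : ChartedSpace (Fin r → ℂ) (T.leaf x y),
      KahlerLeaves.IsEmbeddedComplexManifold (V := Fin r → ℂ) (T.leaf x y) ∧
      (∀ p : T.leaf x y, KahlerLeaves.holTangent (V := Fin r → ℂ) (T.leaf x y) p =
        (KahlerLeaves.tPart T σ F : Set ((ℂ ⊗[ℝ] E) × (ℂ ⊗[ℝ] E)))) ∧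
      KahlerLeaves.IsKahlerForm (V := Fin r → ℂ) (KahlerLeaves.pullbackOmega B (T.leaf x y)) ∧
      KahlerLeaves.IsKahlerPotential (V := Fin r → ℂ) (KahlerLeaves.pullbackOmega B (T.leaf x y))
        (fun p => 2 * σ.im * KahlerLeaves.hamiltonian B F p.1) ∧
      ∃ Φ : Diffeomorph 𝓘(ℂ, Fin r → ℂ) 𝓘(ℂ, Fin r → ℂ)
          (T.leaf x y) (KahlerLeaves.complexTorus r) ω,
        ∀ (t : Fin r → Circle) (p q : T.leaf x y), q.1 = (p.1.1 * T.hom t, p.1.2) →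
          ∀ k, (Φ q).1 k = (t k : ℂ) * (Φ p).1 k := by
  have hσ' : σ.im ≠ 0 := hσ.ne'
  obtain ⟨K⟩ := hF.nonempty_section
  refine ⟨?_, K.leafChartedSpace hσ' x y, K.isEmbeddedComplexManifold hσ' x y,
    K.holTangent_eq hσ' x y hF, K.isKahlerForm hσ' x y hF hσ, K.isKahlerPotential hσ' x y hF, ?_⟩
  · rw [KahlerLeaves.realDistribution_tPart hσ' hF, T.leafThrough_eq]
  · obtain ⟨Φ, hΦ⟩ := K.exists_diffeomorph hσ' x y
    refine ⟨Φ, fun t p q h k => ?_⟩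
    rw [hΦ, hΦ]
    exact K.leafChart_smul hσ' x y t h k
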